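/- Notation. For $\alpha\in\mathbb R$, $1\le p<\infty$ let $L_p^{\alpha}=\{\varphi:\mathbb R\to\mathbb C:\ (1+x_+)^{\alpha}\varphi\in L_p(\mathbb R)\}$, $x_+=\max(x,0)$, with the natural norm. Let $T>0$, $\Pi_T=(0,T)\times\mathbb R$, let $\mathcal S$ be the Schwartz space of complex-valued functions on $\mathbb R$, $\mathcal S'$ its dual, and let $C^\infty([0,T];\mathcal S)$ carry its Fréchet topology; $(C^\infty([0,T];\mathcal S))'$ is its dual. A function $g$ on $\Pi_T$ (on $\mathbb R$) is identified with the functional $\phi\mapsto\iint_{\Pi_T} g\phi\,dx\,dt$ (with $\phi\mapsto\int g\phi\,dx$) whenever the integral converges absolutely for all test functions and the functional is continuous. Let $a,b\in\mathbb R$. For $u_0\in\mathcal S'$ and $f_1,f_2\in (C^\infty([0,T];\mathcal S))'$, a generalized solution in $\Pi_T$ of $$iu_t+au_{xx}+ibu_x+iu_{xxx}=f_1+f_{2x},\qquad u|_{t=0}=u_0,$$ is an element $u\in (C^\infty([0,T];\mathcal S))'$ such that for every $\phi\in C^\infty([0,T];\mathcal S)$ with $\phi|_{t=T}\equiv 0$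 $$\langle u,\ i\phi_t-a\phi_{xx}+ib\phi_x+i\phi_{xxx}\rangle+\langle f_1,\phi\rangle-\langle f_2,\phi_x\rangle+i\langle u_0,\phi|_{t=0}\rangle=0 .$$ Let $G(t,\cdot)=\theta(t)\,\mathcal F^{-1}\bigl[e^{it(\xi^3-a\xi^2-b\xi)}\bigr]$, where $\theta$ is the Heaviside function and $\mathcal F^{-1}[m](x)=\frac1{2\pi}\int e^{ix\xi}m(\xi)\,d\xi$ is understood in $\mathcal S'$. Theorem 2.1. Let $T>0$, $\varepsilon>0$, $u_0\in L_2^{1/4+\varepsilon}$, $f_{11}\in L_1(0,T;L_2^{1/4+\varepsilon})$, $f_{12}\in L_1(0,T;L_1^{-1/4})$, $f_2\in L_1(0,T;L_1^{1/4})$, and $f_1=f_{11}+f_{12}$. For every $t>0$ the distribution $G(t,\cdot)$ is given by a continuous function, again denoted by $G(t,\cdot)$, which is differentiable on $\mathbb R$, with derivative $G_x(t,\cdot)$. The functions $u_0$, $f_1$, $f_2$ define elements of $\mathcal S'$, $(C^\infty([0,T];\mathcal S))'$ and $(C^\infty([0,T];\mathcal S))'$ respectively, and there exists a function $u$ on $\Pi_T$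 which defines an element of $(C^\infty([0,T];\mathcal S))'$, is a generalized solution of the problem above in $\Pi_T$, and satisfies $$u(t,x)=\int G(t,x-y)u_0(y)\,dy-i\int_0^t\!\!\int G(t-\tau,x-y)f_1(\tau,y)\,dy\,d\tau-i\int_0^t\!\!\int G_x(t-\tau,x-y)f_2(\tau,y)\,dy\,d\tau$$ at every point $(t,x)\in\Pi_T$ at which the two double integrals converge absolutely. The first integral converges absolutely at every point of $\Pi_T$, and the two double integrals converge absolutely for almost every $t\in(0,T)$ and all $x\in\mathbb R$. -/

import Mathlib

open MeasureTheory Set Filter Topology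
open scoped SchwartzMap FourierTransform ENNReal

noncomputable section

namespace HNLS

/-- `φ ∈ L_p^α`, i.e. `(1 + x₊)^α φ ∈ L_p(ℝ)`. -/
def MemWeightedLp (α : ℝ) (p : ℝ≥0∞) (φ : ℝ → ℂ) : Prop :=
  MemLp (fun x : ℝ => (1 + max x 0) ^ α • φ x) p volume

/-- The open strip `Π_T = (0,T) × ℝ`. -/
def strip (T : ℝ) : Set (ℝ × ℝ) := Ioo 0 T ×ˢ univ

/-- `f ∈ L_1(0,T; L_p^α)`: `f` is measurable on the strip and the norm
`∫_0^T ‖(1 + x₊)^α f(t,·)‖_{L_p} dt` is finite. -/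
def MemL1WeightedLp (T α : ℝ) (p : ℝ≥0∞) (f : ℝ → ℝ → ℂ) : Prop :=
  AEStronglyMeasurable (Function.uncurry f) (volume.restrict (strip T)) ∧
    ∫⁻ t in Ioo 0 T, eLpNorm (fun x : ℝ => (1 + max x 0) ^ α • f t x) p volume < ∞

/-- The space `C^∞([0,T]; 𝓢(ℝ))` with its Fréchet topology. An element is stored together with
its time derivatives: `D j` is the `j`-th time derivative, a continuous map `[0,T] → 𝓢(ℝ)`, and
`D (j+1)` is the (one-sided at the endpoints) derivative of `D j` in the topology of `𝓢(ℝ)`. The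
topology is that of uniform convergence on `[0,T]` in `𝓢(ℝ)` of all time derivatives. -/
def TestSpace (T : ℝ) : Submodule ℂ (ℕ → C(Icc (0 : ℝ) T, 𝓢(ℝ, ℂ))) where
  carrier := {D | ∀ (j : ℕ) (t : Icc (0 : ℝ) T),
    Tendsto (fun s : Icc (0 : ℝ) T => ((s : ℝ) - t)⁻¹ • (D j s - D j t))
      (𝓝[≠] t) (𝓝 (D (j + 1) t))}
  zero_mem' := by
    intro j t
    simpa using tendsto_const_nhds
  add_mem' := by
    intro D E hD hE j t
    refine ((hD j t).add (hE j t)).congr fun s => ?_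
    simp only [Pi.add_apply, ContinuousMap.add_apply, ← smul_add]
    congr 1
    abel
  smul_mem' := by
    intro c D hD j t
    refine ((hD j t).const_smul c).congr fun s => ?_
    simp only [Pi.smul_apply, ContinuousMap.smul_apply, ← smul_sub]
    rw [smul_comm]

/-- The value `φ(t) ∈ 𝓢(ℝ)`, `t ∈ [0,T]`. -/
def valueAt {T : ℝ} (φ : TestSpace T) (t : Icc (0 : ℝ) T) : 𝓢(ℝ, ℂ) := φ.1 0 t

/-- The function `φ(t,x)` on `[0,T] × ℝ`, extended by zero to the other values of `t`. -/
def evalAt {T : ℝ} (φ : TestSpace T) (t x : ℝ) : ℂ :=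
  open Classical in if h : t ∈ Icc (0 : ℝ) T then valueAt φ ⟨t, h⟩ x else 0

/-- The time derivative `φ_t`. -/
def timeDeriv {T : ℝ} (φ : TestSpace T) : TestSpace T :=
  ⟨fun j => φ.1 (j + 1), fun j t => φ.2 (j + 1) t⟩

/-- The space derivative `φ_x`. -/
def spaceDeriv {T : ℝ} (φ : TestSpace T) : TestSpace T :=
  ⟨fun j => ⟨fun t => SchwartzMap.derivCLM ℂ ℂ (φ.1 j t),
      (SchwartzMap.derivCLM ℂ ℂ).continuous.comp (φ.1 j).continuous⟩, by
    intro j t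
    refine (((SchwartzMap.derivCLM ℂ ℂ).continuous.tendsto _).comp (φ.2 j t)).congr fun s => ?_
    rw [Function.comp_apply, ← Complex.coe_smul, map_smul, map_sub, Complex.coe_smul]
    rfl⟩

/-- The dual space `(C^∞([0,T]; 𝓢(ℝ)))'` of continuous linear functionals. -/
abbrev DualSpace (T : ℝ) : Type := TestSpace T →L[ℂ] ℂ

/-- The functional `F` is the one given by the function `f` on the strip,
`⟨F, φ⟩ = ∬_{Π_T} f φ dx dt`. -/
def IsGivenBy {T : ℝ} (F : DualSpace T) (f : ℝ → ℝ → ℂ) : Prop :=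
  ∀ φ : TestSpace T,
    IntegrableOn (fun p : ℝ × ℝ => f p.1 p.2 * evalAt φ p.1 p.2) (strip T) ∧
      F φ = ∫ p in strip T, f p.1 p.2 * evalAt φ p.1 p.2

/-- The tempered distribution `V` is the one given by the function `g` on the line,
`⟨V, ψ⟩ = ∫ g ψ dx`. -/
def IsTemperedGivenBy (V : 𝓢'(ℝ, ℂ)) (g : ℝ → ℂ) : Prop :=
  ∀ ψ : 𝓢(ℝ, ℂ), Integrable (fun x : ℝ => g x * ψ x) ∧ V ψ = ∫ x : ℝ, g x * ψ x

/-- `u` is a generalized solution in `Π_T` of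
`i u_t + a u_xx + i b u_x + i u_xxx = f₁ + ∂ₓ f₂`, `u|_{t=0} = u₀`. -/
def IsGeneralizedSolution {T : ℝ} (hT : 0 ≤ T) (a b : ℝ) (u₀ : 𝓢'(ℝ, ℂ))
    (f₁ f₂ u : DualSpace T) : Prop :=
  ∀ φ : TestSpace T, valueAt φ ⟨T, right_mem_Icc.2 hT⟩ = 0 →
    u (Complex.I • timeDeriv φ - (a : ℂ) • spaceDeriv (spaceDeriv φ)
        + (Complex.I * b) • spaceDeriv φ
        + Complex.I • spaceDeriv (spaceDeriv (spaceDeriv φ)))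
      + f₁ φ - f₂ (spaceDeriv φ) + Complex.I * u₀ (valueAt φ ⟨0, left_mem_Icc.2 hT⟩) = 0

/-- The symbol `ξ ↦ exp(i t (ξ³ - a ξ² - b ξ))`. -/
def symbol (a b t ξ : ℝ) : ℂ :=
  Complex.exp (Complex.I * ((t * (ξ ^ 3 - a * ξ ^ 2 - b * ξ) : ℝ) : ℂ))

theorem memLp_symbol (a b t : ℝ) :
    MemLp (fun η : ℝ => symbol a b t (2 * Real.pi * η)) ∞ volume := by
  refine memLp_top_of_bound (Continuous.aestronglyMeasurable ?_) 1 (ae_of_all _ fun η => ?_)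
  · unfold symbol
    fun_prop
  · rw [symbol, mul_comm, Complex.norm_exp_ofReal_mul_I]

/-- The tempered distribution `𝓕⁻¹[exp(i t (ξ³ - a ξ² - b ξ))]`, where
`𝓕⁻¹[m](x) = (2π)⁻¹ ∫ exp(i x ξ) m(ξ) dξ`. The inverse transform of Mathlib has the kernel
`exp(2 π i x η)`, so it is applied to `m(2πη)` (substitution `ξ = 2πη`). -/
def fundamentalDistribution (a b t : ℝ) : 𝓢'(ℝ, ℂ) :=
  𝓕⁻ (Lp.toTemperedDistribution (memLp_symbol a b t).toLp)

open Classical in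
/-- The fundamental solution `G(t,x) = θ(t) 𝓕⁻¹[exp(i t (ξ³ - a ξ² - b ξ))](x)` as a function:
for `t > 0` it is the continuous function which gives the tempered distribution `𝓕⁻¹[…]`. -/
def G (a b t x : ℝ) : ℂ :=
  if h : 0 < t ∧ ∃ g : ℝ → ℂ, Continuous g ∧
      IsTemperedGivenBy (fundamentalDistribution a b t) g then
    Classical.choose h.2 x
  else 0

/-- The derivative `G_x`. -/
def Gx (a b t x : ℝ) : ℂ := deriv (G a b t) x

/-- Both double integrals of the Duhamel formula converge absolutely at the point `(t,x)`. -/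
def DuhamelConvergesAt (a b : ℝ) (f₁ f₂ : ℝ → ℝ → ℂ) (t x : ℝ) : Prop :=
  IntegrableOn (fun q : ℝ × ℝ => G a b (t - q.1) (x - q.2) * f₁ q.1 q.2) (strip t) ∧
    IntegrableOn (fun q : ℝ × ℝ => Gx a b (t - q.1) (x - q.2) * f₂ q.1 q.2) (strip t)

/-- The right-hand side of the Duhamel formula. -/
def duhamel (a b : ℝ) (u₀ : ℝ → ℂ) (f₁ f₂ : ℝ → ℝ → ℂ) (t x : ℝ) : ℂ :=
  (∫ y : ℝ, G a b t (x - y) * u₀ y)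
    - Complex.I * (∫ τ in (0 : ℝ)..t, ∫ y : ℝ, G a b (t - τ) (x - y) * f₁ τ y)
    - Complex.I * (∫ τ in (0 : ℝ)..t, ∫ y : ℝ, Gx a b (t - τ) (x - y) * f₂ τ y)

end HNLS

end

/-! The solution is the Duhamel formula itself, so what is needed is a pointwise description of $G$
with weighted bounds, and a proof that $G$ inverts the adjoint operator on test functions.

Removing the quadratic term of the phase by $\xi = a/3 + w$ and rescaling by $t^{1/3}$ gives $G(t,x)
= e^{i(\dots)}\, t^{-1/3} A\bigl((x-\kappa t)/t^{1/3}\bigr)$ with $\kappa = a^2/3+b$ and an Airy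
profile $A$ solving $A'' = (z/3)A$. The profile is defined by integrating over the line
$\operatorname{Im}\zeta = 1$, where the cubic phase becomes Gaussian decay. The result does not
depend on the height of the line, and letting the height tend to $0$ identifies the oscillatory
distribution (`integral_symbol_mul_fourierInv`, `G_eq_airyKernel`).

To the right, $A$ and $A'$ are $O(e^{-z})$, directly from the contour. To the left, a monotone
energy for the Airy equation gives $|A| \lesssim |z|^{-1/4}$ and $|A'| \lesssim |z|^{1/4}$
(`exists_norm_airy_le`). Hence $G(t,x-y)$ and $G_x(t,x-y)$ are at most $C t^{-3/4}(1+|x|)^2$ times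
`leftWeight y` and `rightWeight y` respectively (`exists_norm_airyKernel_sub_le`). The singularity
$t^{-3/4}$ is integrable, and the data are integrable against these weights: for the $L_2$ data by
Cauchy–Schwarz, which is where $\varepsilon > 0$ enters. Fubini then gives absolute convergence for
almost every $t$ and all $x$, and polynomial growth of $u$ in the mean.

For the weak equation, Fubini moves the kernel onto the test function. On the Fourier side the
adjoint operator is $i(\partial_t + ip(\xi))$ with $p(\xi)=\xi^3-a\xi^2-b\xi$, and multiplied by
$e^{i(t-\tau)p}$ it is an exact $t$-derivative. Thus the retarded kernel applied to the adjoint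
operator of $\phi$ returns $-i\phi(\tau,y)$ (`integral_integral_airyKernel_mul_adjointOp`), and
integration by parts gives the analogue for $G_x$. Initial data are treated as a density on the line
$t=0$, so one argument covers all three terms. -/

/-! ## Contour integrals for the Airy profile -/

namespace HNLS

/-- The entire function `exp(i ζ³ + i z ζ)` on the line `ζ = s + iσ`. -/
noncomputable def airyIntegrand (σ z s : ℝ) : ℂ :=
  Complex.exp (Complex.I * ((s : ℂ) + σ * Complex.I) ^ 3
    + Complex.I * z * ((s : ℂ) + σ * Complex.I))

/-- Off the real axis the cubic phase acquires the real part $-3\sigma s^2$. For $\sigma>0$ this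
makes every integral below absolutely convergent. -/
theorem norm_airyIntegrand (σ z s : ℝ) :
    ‖airyIntegrand σ z s‖ = Real.exp (-3 * σ * s ^ 2 + σ ^ 3 - z * σ) := by
  rw [airyIntegrand, Complex.norm_exp]
  congr 1
  simp [pow_succ]
  ring

theorem continuous_airyIntegrand (σ z : ℝ) : Continuous (airyIntegrand σ z) := by
  unfold airyIntegrand
  fun_prop

/-- A Gaussian bound, uniform for `σ ∈ [m, M]` and `|z| ≤ R`. -/
theorem norm_pow_mul_airyIntegrand_le {m M R σ z : ℝ} (hm : 0 < m) (h1 : m ≤ σ) (h2 : σ ≤ M)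
    (hz : |z| ≤ R) (k : ℕ) (s : ℝ) :
    ‖((s : ℂ) + σ * Complex.I) ^ k * airyIntegrand σ z s‖
      ≤ k.factorial * Real.exp (M + 1 / (8 * m) + M ^ 3 + R * M) * Real.exp (-m * s ^ 2) := by
  have hσ : 0 < σ := hm.trans_le h1
  have hR : 0 ≤ R := (abs_nonneg z).trans hz
  rw [norm_mul, norm_pow, norm_airyIntegrand]
  have a1 : ‖(s : ℂ) + σ * Complex.I‖ ≤ |s| + M := by
    refine (norm_add_le _ _).trans ?_
    simp only [norm_mul, Complex.norm_I, mul_one, Complex.norm_real, Real.norm_eq_abs]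
    rw [abs_of_pos hσ]
    linarith
  have a2 : (|s| + M) ^ k ≤ k.factorial * Real.exp (|s| + M) := by
    have hM : 0 ≤ M := hσ.le.trans h2
    have := Real.pow_div_factorial_le_exp (|s| + M) (by positivity) k
    rwa [div_le_iff₀' (by positivity)] at this
  -- Completing the square lets two thirds of the available decay $-3ms^2$ absorb $e^{|s|}$, which
  -- leaves $e^{-ms^2}$.
  have a3 : |s| ≤ 2 * m * s ^ 2 + 1 / (8 * m) := by
    have : 2 * m * s ^ 2 + 1 / (8 * m) - |s| = 2 * m * (|s| - 1 / (4 * m)) ^ 2 := by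
      rw [← sq_abs s]
      field_simp
      ring
    have h : 0 ≤ 2 * m * (|s| - 1 / (4 * m)) ^ 2 := by positivity
    linarith
  have a4 : σ ^ 3 ≤ M ^ 3 := by gcongr
  have a5 : -(z * σ) ≤ R * M := by
    have := neg_abs_le z
    nlinarith
  have a6 : m * s ^ 2 ≤ σ * s ^ 2 := by gcongr
  calc _ ≤ (|s| + M) ^ k * Real.exp (-3 * σ * s ^ 2 + σ ^ 3 - z * σ) := by gcongr
    _ ≤ k.factorial * Real.exp (|s| + M) * Real.exp (-3 * σ * s ^ 2 + σ ^ 3 - z * σ) := by gcongr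
    _ = k.factorial * Real.exp (|s| + M + (-3 * σ * s ^ 2 + σ ^ 3 - z * σ)) := by
        rw [mul_assoc, ← Real.exp_add]
    _ ≤ k.factorial * Real.exp (M + 1 / (8 * m) + M ^ 3 + R * M + -m * s ^ 2) := by
        refine mul_le_mul_of_nonneg_left (Real.exp_le_exp.2 ?_) (by positivity)
        linarith
    _ = _ := by rw [Real.exp_add _ (-m * s ^ 2), mul_assoc]

theorem integrable_pow_mul_airyIntegrand {σ : ℝ} (hσ : 0 < σ) (z : ℝ) (k : ℕ) :
    Integrable fun s : ℝ => ((s : ℂ) + σ * Complex.I) ^ k * airyIntegrand σ z s := by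
  refine ((integrable_exp_neg_mul_sq hσ).const_mul _).mono' ?_
    (ae_of_all _ fun s => norm_pow_mul_airyIntegrand_le hσ le_rfl le_rfl le_rfl k s)
  exact (Continuous.mul (by fun_prop) (continuous_airyIntegrand σ z)).aestronglyMeasurable

theorem integrable_airyIntegrand {σ : ℝ} (hσ : 0 < σ) (z : ℝ) : Integrable (airyIntegrand σ z) := by
  simpa using integrable_pow_mul_airyIntegrand hσ z 0

/-- `∫ ζ^k exp(i ζ³ + i z ζ) dζ` over the line `Im ζ = σ`. -/
noncomputable def airyMoment (σ : ℝ) (k : ℕ) (z : ℝ) : ℂ :=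
  ∫ s : ℝ, ((s : ℂ) + σ * Complex.I) ^ k * airyIntegrand σ z s

theorem hasDerivAt_airyMoment {σ : ℝ} (hσ : 0 < σ) (k : ℕ) (z : ℝ) :
    HasDerivAt (airyMoment σ k) (Complex.I * airyMoment σ (k + 1) z) z := by
  have key := (hasDerivAt_integral_of_dominated_loc_of_deriv_le (μ := volume)
    (F := fun w s : ℝ => ((s : ℂ) + σ * Complex.I) ^ k * airyIntegrand σ w s)
    (F' := fun w s : ℝ => Complex.I * (((s : ℂ) + σ * Complex.I) ^ (k + 1) * airyIntegrand σ w s))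
    (bound := fun s => (k + 1).factorial * Real.exp (σ + 1 / (8 * σ) + σ ^ 3 + (|z| + 1) * σ)
      * Real.exp (-σ * s ^ 2))
    (x₀ := z) (s := Metric.ball z 1) (Metric.ball_mem_nhds z one_pos)
    (Eventually.of_forall fun w => (integrable_pow_mul_airyIntegrand hσ w k).aestronglyMeasurable)
    (integrable_pow_mul_airyIntegrand hσ z k)
    ((integrable_pow_mul_airyIntegrand hσ z (k + 1)).const_mul _).aestronglyMeasurable
    (ae_of_all _ fun s w hw => ?_) ((integrable_exp_neg_mul_sq hσ).const_mul _)
    (ae_of_all _ fun s w _ => ?_)).2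
  · rw [integral_const_mul] at key
    exact key
  · rw [norm_mul, Complex.norm_I, one_mul]
    refine norm_pow_mul_airyIntegrand_le hσ le_rfl le_rfl ?_ (k + 1) s
    rw [Metric.mem_ball, Real.dist_eq] at hw
    have := abs_sub_abs_le_abs_sub w z
    linarith
  · have h1 : HasDerivAt (fun w : ℝ => (w : ℂ)) 1 w := Complex.ofRealCLM.hasDerivAt
    have h2 := ((((h1.const_mul Complex.I).mul_const ((s : ℂ) + σ * Complex.I)).const_add
      (Complex.I * ((s : ℂ) + σ * Complex.I) ^ 3)).cexp).const_mul
        (((s : ℂ) + σ * Complex.I) ^ k)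
    refine h2.congr_deriv ?_
    rw [airyIntegrand]
    ring

/-- The derivative of the integrand along the line is a total derivative. -/
theorem hasDerivAt_airyIntegrand (σ z s : ℝ) :
    HasDerivAt (airyIntegrand σ z)
      (Complex.I * (3 * (((s : ℂ) + σ * Complex.I) ^ 2 * airyIntegrand σ z s)
        + z * airyIntegrand σ z s)) s := by
  have h1 : HasDerivAt (fun w : ℝ => (w : ℂ) + σ * Complex.I) 1 s :=
    Complex.ofRealCLM.hasDerivAt.add_const _
  have h2 := (((h1.pow 3).const_mul Complex.I).add (h1.const_mul (Complex.I * z))).cexp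
  refine h2.congr_deriv ?_
  simp only [Pi.pow_apply, airyIntegrand, Pi.add_apply]
  ring

/-- By holomorphy in $\zeta = s + i\sigma$, this is $i$ times the derivative along the line
(Cauchy–Riemann). -/
theorem hasDerivAt_airyIntegrand_height (σ z s : ℝ) :
    HasDerivAt (fun r => airyIntegrand r z s)
      (-(3 * (((s : ℂ) + σ * Complex.I) ^ 2 * airyIntegrand σ z s)
        + z * airyIntegrand σ z s)) σ := by
  have h1 : HasDerivAt (fun w : ℝ => (s : ℂ) + w * Complex.I) (1 * Complex.I) σ :=
    (Complex.ofRealCLM.hasDerivAt.mul_const _).const_add _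
  have h2 := (((h1.pow 3).const_mul Complex.I).add (h1.const_mul (Complex.I * z))).cexp
  refine h2.congr_deriv ?_
  simp only [Pi.pow_apply, airyIntegrand, Pi.add_apply]
  linear_combination (Complex.exp (Complex.I * ((s : ℂ) + σ * Complex.I) ^ 3
    + Complex.I * z * ((s : ℂ) + σ * Complex.I))) *
      (3 * ((s : ℂ) + σ * Complex.I) ^ 2 + z) * Complex.I_sq

/-- The integral of a total derivative vanishes. This one identity yields both the independence of
the height and the Airy equation. -/
theorem three_mul_airyMoment_two {σ : ℝ} (hσ : 0 < σ) (z : ℝ) :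
    3 * airyMoment σ 2 z + z * airyMoment σ 0 z = 0 := by
  have i2 := (integrable_pow_mul_airyIntegrand hσ z 2).const_mul 3
  have i0 := (integrable_airyIntegrand hσ z).const_mul (z : ℂ)
  have h := integral_eq_zero_of_hasDerivAt_of_integrable (hasDerivAt_airyIntegrand σ z)
    ((i2.add i0).const_mul Complex.I) (integrable_airyIntegrand hσ z)
  rw [integral_const_mul, integral_add i2 i0, integral_const_mul, integral_const_mul] at h
  have := (mul_eq_zero.1 h).resolve_left Complex.I_ne_zero
  simpa [airyMoment] using this

/-- A contour shift without contours: the height derivative of the integrand is $i$ times a total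
$s$-derivative, so its integral is zero. -/
theorem hasDerivAt_airyMoment_height {σ : ℝ} (hσ : 0 < σ) (z : ℝ) :
    HasDerivAt (fun r => airyMoment r 0 z) 0 σ := by
  have hm : 0 < σ / 2 := by positivity
  have i2 := (integrable_pow_mul_airyIntegrand hσ z 2).const_mul 3
  have i0 := (integrable_airyIntegrand hσ z).const_mul (z : ℂ)
  have hev : ∀ᶠ r in 𝓝 σ, 0 < r := lt_mem_nhds hσ
  have key := (hasDerivAt_integral_of_dominated_loc_of_deriv_le (μ := volume)
    (F := fun r s : ℝ => airyIntegrand r z s)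
    (F' := fun r s : ℝ => -(3 * (((s : ℂ) + r * Complex.I) ^ 2 * airyIntegrand r z s)
        + z * airyIntegrand r z s))
    -- The Gaussian bound is applied with $m=\sigma/2$, $M=2\sigma$, uniformly over heights in
    -- $[\sigma/2, 2\sigma]$.
    (bound := fun s => 3 * ((Nat.factorial 2) * Real.exp (2 * σ + 1 / (8 * (σ / 2)) + (2 * σ) ^ 3
      + |z| * (2 * σ)) * Real.exp (-(σ / 2) * s ^ 2)) +
      |z| * ((Nat.factorial 0) * Real.exp (2 * σ + 1 / (8 * (σ / 2)) + (2 * σ) ^ 3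
      + |z| * (2 * σ)) * Real.exp (-(σ / 2) * s ^ 2)))
    (x₀ := σ) (s := Icc (σ / 2) (2 * σ)) (Icc_mem_nhds (by linarith) (by linarith))
    (hev.mono fun r hr => (integrable_airyIntegrand hr z).aestronglyMeasurable)
    (integrable_airyIntegrand hσ z)
    (i2.add i0).neg.aestronglyMeasurable
    (ae_of_all _ fun s r hr => ?_)
    ((((integrable_exp_neg_mul_sq hm).const_mul _).const_mul _).add
      (((integrable_exp_neg_mul_sq hm).const_mul _).const_mul _))
    (ae_of_all _ fun s r _ => hasDerivAt_airyIntegrand_height r z s)).2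
  · rw [integral_neg, integral_add i2 i0, integral_const_mul, integral_const_mul] at key
    have h := three_mul_airyMoment_two hσ z
    simp only [airyMoment, pow_zero, one_mul] at h ⊢
    rwa [h, neg_zero] at key
  · rw [norm_neg]
    refine (norm_add_le _ _).trans (add_le_add ?_ ?_)
    · rw [norm_mul]
      gcongr
      · simp
      · exact norm_pow_mul_airyIntegrand_le hm hr.1 hr.2 le_rfl 2 s
    · rw [norm_mul, Complex.norm_real, Real.norm_eq_abs]
      gcongr
      simpa using norm_pow_mul_airyIntegrand_le hm hr.1 hr.2 le_rfl 0 s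

theorem airyMoment_zero_eq {σ : ℝ} (hσ : 0 < σ) (z : ℝ) : airyMoment σ 0 z = airyMoment 1 0 z := by
  refine (convex_Ioi (0 : ℝ)).is_const_of_fderivWithin_eq_zero (𝕜 := ℝ)
    (f := fun r => airyMoment r 0 z)
    (fun r hr => (hasDerivAt_airyMoment_height hr z).differentiableAt.differentiableWithinAt)
    (fun r hr => ?_) hσ (mem_Ioi.2 one_pos)
  rw [fderivWithin_of_isOpen isOpen_Ioi hr, (hasDerivAt_airyMoment_height hr z).hasFDerivAt.fderiv]
  ext
  simp

/-- At height $1$ the modulus of the integrand depends on $z$ only through the factor $e^{-z}$, so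
the constant is the integral at $z=0$. -/
theorem norm_airyMoment_le (k : ℕ) :
    ∃ C, 0 ≤ C ∧ ∀ z, ‖airyMoment 1 k z‖ ≤ C * Real.exp (-z) := by
  refine ⟨∫ s : ℝ, ‖((s : ℂ) + (1 : ℝ) * Complex.I) ^ k * airyIntegrand 1 0 s‖, by positivity,
    fun z => ?_⟩
  rw [← integral_mul_const]
  refine (norm_integral_le_integral_norm _).trans (le_of_eq ?_)
  congr 1
  ext s
  rw [norm_mul, norm_mul, norm_airyIntegrand, norm_airyIntegrand, mul_assoc (‖_‖ : ℝ), ← Real.exp_add]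
  congr 2
  ring

/-- The profile `(2π)⁻¹ ∫ exp(i s³ + i z s) ds` of the fundamental solution, a rescaled Airy
function. -/
noncomputable def airy (z : ℝ) : ℂ := (2 * Real.pi : ℂ)⁻¹ * airyMoment 1 0 z

/-- The derivative of `airy`. -/
noncomputable def airyDeriv (z : ℝ) : ℂ := (2 * Real.pi : ℂ)⁻¹ * (Complex.I * airyMoment 1 1 z)

theorem hasDerivAt_airy (z : ℝ) : HasDerivAt airy (airyDeriv z) z :=
  (hasDerivAt_airyMoment one_pos 0 z).const_mul _

theorem hasDerivAt_airyDeriv (z : ℝ) : HasDerivAt airyDeriv ((z / 3 : ℝ) • airy z) z := by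
  refine (((hasDerivAt_airyMoment one_pos 1 z).const_mul Complex.I).const_mul _).congr_deriv ?_
  have h := three_mul_airyMoment_two one_pos z
  rw [airy, Complex.real_smul]
  push_cast
  linear_combination (2 * Real.pi : ℂ)⁻¹ * (-1 / 3 * h + airyMoment 1 2 z * Complex.I_sq)

theorem continuous_airy : Continuous airy :=
  continuous_iff_continuousAt.2 fun z => (hasDerivAt_airy z).continuousAt

theorem continuous_airyDeriv : Continuous airyDeriv :=
  continuous_iff_continuousAt.2 fun z => (hasDerivAt_airyDeriv z).continuousAt

/-- `airy` is, up to an exponential factor, the inverse transform of `exp(i (s + iσ)³)`. -/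
theorem integral_exp_cube_eq {σ : ℝ} (hσ : 0 < σ) (z : ℝ) :
    ∫ s : ℝ, Complex.exp (Complex.I * ((s : ℂ) + σ * Complex.I) ^ 3 + Complex.I * z * s)
      = 2 * Real.pi * (Real.exp (σ * z) * airy z) := by
  have h : ∀ s : ℝ, Complex.exp (Complex.I * ((s : ℂ) + σ * Complex.I) ^ 3 + Complex.I * z * s)
      = Real.exp (σ * z) * airyIntegrand σ z s := fun s => by
    rw [airyIntegrand, Complex.ofReal_exp, ← Complex.exp_add]
    congr 1
    push_cast
    linear_combination -(σ * z : ℂ) * Complex.I_sq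
  simp_rw [h]
  rw [integral_const_mul, airy, ← airyMoment_zero_eq hσ z]
  have hpi : (Real.pi : ℂ) ≠ 0 := by exact_mod_cast Real.pi_ne_zero
  simp only [airyMoment, pow_zero, one_mul]
  field_simp

end HNLS

/-! ## Bounds for the Airy profile -/

namespace HNLS

/-- The corrected energy of a solution `y`, `v = y'` of `y'' = -(x/3) y`, with `r = √x`. -/
noncomputable def airyEnergy (r y v : ℝ) : ℝ := r * y ^ 2 + 3 * v ^ 2 / r + 3 / 2 * (y * v) / r ^ 3

/-- The main part $ry^2+3v^2/r$ dominates $3|yv|$ by completing the square, while for $r\ge1$ the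
correction is at most half of that. So the corrected energy is comparable with the main part. -/
theorem abs_mul_le_airyEnergy {r : ℝ} (hr : 1 ≤ r) (y v : ℝ) :
    r * y ^ 2 + 3 * v ^ 2 / r ≤ 2 * airyEnergy r y v ∧ 3 / 2 * |y * v| ≤ airyEnergy r y v := by
  have h0 : 0 < r := by linarith
  have h1 : 3 * |y * v| ≤ r * y ^ 2 + 3 * v ^ 2 / r := by
    have e : r * y ^ 2 + 3 * v ^ 2 / r - 3 * |y * v|
        = (1 / r) * ((r * |y| - 3 / 2 * |v|) ^ 2 + 3 / 4 * |v| ^ 2) := by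
      rw [abs_mul, ← sq_abs y, ← sq_abs v]
      field_simp
      ring
    have : 0 ≤ (1 / r) * ((r * |y| - 3 / 2 * |v|) ^ 2 + 3 / 4 * |v| ^ 2) := by positivity
    linarith
  have h2 : |3 / 2 * (y * v) / r ^ 3| ≤ 3 / 2 * |y * v| := by
    rw [abs_div, abs_mul, abs_of_pos (by norm_num : (0 : ℝ) < 3 / 2),
      abs_of_pos (pow_pos h0 3)]
    exact div_le_self (by positivity) (one_le_pow₀ hr)
  have h3 := neg_abs_le (3 / 2 * (y * v) / r ^ 3)
  constructor <;> unfold airyEnergy <;> linarith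

/-- The main part $ry^2+3v^2/r$ has derivative $y^2/(2r)-3v^2/(2r^3)$, too large to integrate
directly. The correction cancels exactly this and leaves $E' = -\tfrac94 yv/r^5$. Since
$\tfrac32|yv|\le E$, a Gronwall factor makes the product nonincreasing. -/
theorem exists_airyEnergy_le {y v : ℝ → ℝ} (hy : ∀ x, 1 ≤ x → HasDerivAt y (v x) x)
    (hv : ∀ x, 1 ≤ x → HasDerivAt v (-(x / 3) * y x) x) :
    ∃ C, 0 ≤ C ∧ ∀ x, 1 ≤ x → airyEnergy (√x) (y x) (v x) ≤ C := by
  -- The factor $e^{1/r^3}$ has logarithmic derivative $-\tfrac32 r^{-5}$, just enough to absorb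
  -- $\tfrac94|yv|/r^5$. It lies between $1$ and $e$ for $x\ge1$.
  set H : ℝ → ℝ := fun x => airyEnergy (√x) (y x) (v x) * Real.exp (1 / √x ^ 3) with hH
  have hder : ∀ x, 1 ≤ x → HasDerivAt H
      ((-(9 / 4) * (y x * v x) - 3 / 2 * airyEnergy (√x) (y x) (v x)) / √x ^ 5
        * Real.exp (1 / √x ^ 3)) x := by
    intro x hx
    have hx0 : 0 < x := by linarith
    have hr : √x ≠ 0 := by positivity
    have hs := Real.hasDerivAt_sqrt hx0.ne'
    have d1 := hs.mul ((hy x hx).pow 2)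
    have d2 := (((hv x hx).pow 2).const_mul 3).div hs hr
    have d3 := (((hy x hx).mul (hv x hx)).const_mul (3 / 2)).div (hs.pow 3) (pow_ne_zero 3 hr)
    have d4 := ((hasDerivAt_const x (1 : ℝ)).div (hs.pow 3) (pow_ne_zero 3 hr)).exp
    refine (((d1.add d2).add d3).mul d4).congr_deriv ?_
    have hxr : x = √x ^ 2 := (Real.sq_sqrt hx0.le).symm
    simp only [Pi.add_apply, Pi.mul_apply, Pi.div_apply, Pi.pow_apply, airyEnergy]
    set r := √x
    rw [hxr]
    field_simp
    ring
  have hanti : AntitoneOn H (Ici 1) := by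
    refine antitoneOn_of_deriv_nonpos (convex_Ici 1)
      (fun x hx => (hder x hx).continuousAt.continuousWithinAt)
      (fun x hx => (hder x (interior_subset hx)).differentiableAt.differentiableWithinAt)
      (fun x hx => ?_)
    have hx1 : 1 ≤ x := interior_subset hx
    rw [(hder x hx1).deriv]
    have hr : 1 ≤ √x := Real.one_le_sqrt.2 hx1
    have h := (abs_mul_le_airyEnergy hr (y x) (v x)).2
    have h' := neg_abs_le (y x * v x)
    have : (-(9 / 4) * (y x * v x) - 3 / 2 * airyEnergy (√x) (y x) (v x)) ≤ 0 := by linarith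
    exact mul_nonpos_of_nonpos_of_nonneg (div_nonpos_of_nonpos_of_nonneg this (by positivity))
      (Real.exp_pos _).le
  have hpos : ∀ x, 1 ≤ x → 0 ≤ airyEnergy (√x) (y x) (v x) := fun x hx =>
    le_trans (by positivity) (abs_mul_le_airyEnergy (Real.one_le_sqrt.2 hx) (y x) (v x)).2
  refine ⟨H 1, mul_nonneg (hpos 1 le_rfl) (Real.exp_pos _).le, fun x hx => ?_⟩
  refine le_trans ?_ (hanti (mem_Ici.2 le_rfl) (mem_Ici.2 hx) hx)
  exact le_mul_of_one_le_right (hpos x hx) (Real.one_le_exp (by positivity))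

/-- The classical bounds for real solutions of `y'' = -(x/3) y`. -/
theorem exists_abs_le_rpow_of_airy {y v : ℝ → ℝ} (hy : ∀ x, 1 ≤ x → HasDerivAt y (v x) x)
    (hv : ∀ x, 1 ≤ x → HasDerivAt v (-(x / 3) * y x) x) :
    ∃ C, 0 ≤ C ∧ ∀ x, 1 ≤ x →
      |y x| ≤ C * x ^ (-(1 / 4) : ℝ) ∧ |v x| ≤ C * x ^ (1 / 4 : ℝ) := by
  obtain ⟨C, hC, h⟩ := exists_airyEnergy_le hy hv
  refine ⟨√(2 * C), by positivity, fun x hx => ?_⟩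
  have hx0 : 0 < x := by linarith
  have hr : 0 < √x := by positivity
  have h1 := (abs_mul_le_airyEnergy (Real.one_le_sqrt.2 hx) (y x) (v x)).1
  have h2 := h x hx
  have h3 : 0 ≤ √x * y x ^ 2 := by positivity
  have h4 : 0 ≤ 3 * v x ^ 2 / √x := by positivity
  have e1 : (x ^ (-(1 / 4) : ℝ)) ^ 2 = (√x)⁻¹ := by
    rw [← Real.rpow_natCast, ← Real.rpow_mul hx0.le, Real.sqrt_eq_rpow, ← Real.rpow_neg hx0.le]
    norm_num
  have e2 : (x ^ (1 / 4 : ℝ)) ^ 2 = √x := by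
    rw [← Real.rpow_natCast, ← Real.rpow_mul hx0.le, Real.sqrt_eq_rpow]
    norm_num
  constructor
  · refine abs_le_of_sq_le_sq ?_ (by positivity)
    rw [mul_pow, Real.sq_sqrt (by positivity), e1, ← div_eq_mul_inv, le_div_iff₀ hr]
    linarith
  · refine abs_le_of_sq_le_sq ?_ (by positivity)
    rw [mul_pow, Real.sq_sqrt (by positivity), e2, ← div_le_iff₀ hr]
    have : 0 ≤ v x ^ 2 / √x := by positivity
    have e : 3 * v x ^ 2 / √x = 3 * (v x ^ 2 / √x) := by ring
    linarith

/-- After $x\mapsto -x$ the profile satisfies $y''=-(x/3)y$. The energy bound is for real solutions,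
so it is applied to the real and imaginary parts. -/
theorem exists_norm_airy_le_left :
    ∃ C, 0 ≤ C ∧ ∀ x, 1 ≤ x →
      ‖airy (-x)‖ ≤ C * x ^ (-(1 / 4) : ℝ) ∧ ‖airyDeriv (-x)‖ ≤ C * x ^ (1 / 4 : ℝ) := by
  have d1 : ∀ x : ℝ, HasDerivAt (fun x => airy (-x)) (-airyDeriv (-x)) x := fun x => by
    exact ((hasDerivAt_airy (-x)).scomp x (hasDerivAt_neg x)).congr_deriv (by simp)
  have d2 : ∀ x : ℝ, HasDerivAt (fun x => -airyDeriv (-x)) (-(x / 3) • airy (-x)) x := fun x => by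
    have := ((hasDerivAt_airyDeriv (-x)).scomp x (hasDerivAt_neg x)).neg
    refine this.congr_deriv ?_
    rw [neg_smul, one_smul, neg_neg, neg_div]
  obtain ⟨A, hA, ha⟩ := exists_abs_le_rpow_of_airy
    (fun x _ => Complex.reCLM.hasFDerivAt.comp_hasDerivAt x (d1 x))
    (fun x _ => (Complex.reCLM.hasFDerivAt.comp_hasDerivAt x (d2 x)).congr_deriv
      (by simp))
  obtain ⟨B, hB, hb⟩ := exists_abs_le_rpow_of_airy
    (fun x _ => Complex.imCLM.hasFDerivAt.comp_hasDerivAt x (d1 x))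
    (fun x _ => (Complex.imCLM.hasFDerivAt.comp_hasDerivAt x (d2 x)).congr_deriv
      (by simp))
  refine ⟨A + B, by positivity, fun x hx => ?_⟩
  obtain ⟨a1, a2⟩ := ha x hx
  obtain ⟨b1, b2⟩ := hb x hx
  simp only [Function.comp_apply, Complex.reCLM_apply, Complex.imCLM_apply, Complex.neg_re,
    Complex.neg_im, abs_neg] at a1 a2 b1 b2
  rw [add_mul, add_mul]
  exact ⟨(Complex.norm_le_abs_re_add_abs_im _).trans (add_le_add a1 b1),
    (Complex.norm_le_abs_re_add_abs_im _).trans (add_le_add a2 b2)⟩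

theorem exists_norm_airy_le_exp :
    ∃ C, 0 ≤ C ∧ ∀ z, ‖airy z‖ ≤ C * Real.exp (-z) ∧ ‖airyDeriv z‖ ≤ C * Real.exp (-z) := by
  obtain ⟨A, hA, ha⟩ := norm_airyMoment_le 0
  obtain ⟨B, hB, hb⟩ := norm_airyMoment_le 1
  have hpi : ‖(2 * Real.pi : ℂ)⁻¹‖ ≤ 1 := by
    rw [norm_inv, norm_mul, Complex.norm_real, Complex.norm_ofNat, Real.norm_eq_abs,
      abs_of_pos Real.pi_pos]
    exact inv_le_one_of_one_le₀ (by linarith [Real.pi_gt_three])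
  refine ⟨A + B, by positivity, fun z => ⟨?_, ?_⟩⟩
  · rw [airy, norm_mul]
    calc _ ≤ 1 * (A * Real.exp (-z)) := by gcongr; exact ha z
      _ ≤ _ := by rw [one_mul]; gcongr; linarith
  · rw [airyDeriv, norm_mul, norm_mul, Complex.norm_I, one_mul]
    calc _ ≤ 1 * (B * Real.exp (-z)) := by gcongr; exact hb z
      _ ≤ _ := by rw [one_mul]; gcongr; linarith

/-- Decay of the profile: oscillation on the left, rapid decay on the right. -/
theorem exists_norm_airy_le :
    ∃ C, 0 ≤ C ∧ ∀ z : ℝ,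
      ‖airy z‖ ≤ C * ((1 + max (-z) 0) ^ (-(1 / 4) : ℝ) * (1 + max z 0)⁻¹) ∧
      ‖airyDeriv z‖ ≤ C * (1 + max (-z) 0) ^ (1 / 4 : ℝ) := by
  obtain ⟨A, hA, ha⟩ := exists_norm_airy_le_left
  obtain ⟨B, hB, hb⟩ := exists_norm_airy_le_exp
  -- The term $2A$ pays for replacing $|z|$ by $1+|z|$ when $z\le-1$. The term $2eB$ covers $-1\le
  -- z\le0$, where $e^{-z}\le e$ and the decaying weight is at least $1/2$.
  refine ⟨2 * A + 2 * Real.exp 1 * B, by positivity, fun z => ?_⟩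
  obtain ⟨b1, b2⟩ := hb z
  have hE : 0 < Real.exp 1 := Real.exp_pos 1
  rcases le_total 0 z with hz | hz
  · rw [max_eq_right (by linarith), max_eq_left hz]
    simp only [add_zero, Real.one_rpow, one_mul, mul_one]
    have hE1 : 1 ≤ Real.exp 1 := Real.one_le_exp zero_le_one
    have e1 : Real.exp (-z) ≤ (1 + z)⁻¹ := by
      rw [Real.exp_neg]
      exact inv_anti₀ (by linarith) (by linarith [Real.add_one_le_exp z])
    have e2 : Real.exp (-z) ≤ 1 := Real.exp_le_one_iff.2 (by linarith)
    have hBC : B ≤ 2 * A + 2 * Real.exp 1 * B := by nlinarith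
    exact ⟨b1.trans (by gcongr),
      b2.trans (by simpa using mul_le_mul hBC e2 (Real.exp_pos _).le (by positivity))⟩
  · rw [max_eq_left (by linarith), max_eq_right hz]
    simp only [add_zero, inv_one, mul_one]
    rcases le_total 1 (-z) with h1 | h1
    · obtain ⟨a1, a2⟩ := ha (-z) h1
      rw [neg_neg] at a1 a2
      have hz0 : 0 < -z := by linarith
      have e1 : (-z) ^ (-(1 / 4) : ℝ) ≤ 2 * (1 + -z) ^ (-(1 / 4) : ℝ) := by
        rw [Real.rpow_neg (by linarith), Real.rpow_neg (by linarith)]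
        have h2 : (1 + -z) ^ (1 / 4 : ℝ) ≤ 2 * (-z) ^ (1 / 4 : ℝ) := by
          calc _ ≤ (2 * -z) ^ (1 / 4 : ℝ) :=
                Real.rpow_le_rpow (by linarith) (by linarith) (by norm_num)
            _ = 2 ^ (1 / 4 : ℝ) * (-z) ^ (1 / 4 : ℝ) := Real.mul_rpow (by norm_num) hz0.le
            _ ≤ 2 ^ (1 : ℝ) * (-z) ^ (1 / 4 : ℝ) := by gcongr <;> norm_num
            _ = _ := by rw [Real.rpow_one]
        have p1 : 0 < (-z) ^ (1 / 4 : ℝ) := by positivity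
        have p2 : 0 < (1 + -z) ^ (1 / 4 : ℝ) := Real.rpow_pos_of_pos (by linarith) _
        rw [← div_eq_mul_inv, le_div_iff₀ p2, inv_mul_le_iff₀ p1]
        linarith
      have e2 : (-z) ^ (1 / 4 : ℝ) ≤ (1 + -z) ^ (1 / 4 : ℝ) :=
        Real.rpow_le_rpow hz0.le (by linarith) (by norm_num)
      have q1 : 0 ≤ (1 + -z) ^ (-(1 / 4) : ℝ) := Real.rpow_nonneg (by linarith) _
      have q2 : 0 ≤ (1 + -z) ^ (1 / 4 : ℝ) := Real.rpow_nonneg (by linarith) _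
      have hB2 : 0 ≤ 2 * Real.exp 1 * B := by positivity
      constructor
      · calc _ ≤ A * (2 * (1 + -z) ^ (-(1 / 4) : ℝ)) := a1.trans (by gcongr)
          _ ≤ _ := by nlinarith
      · calc _ ≤ A * (1 + -z) ^ (1 / 4 : ℝ) := a2.trans (by gcongr)
          _ ≤ _ := by nlinarith
    · have e0 : Real.exp (-z) ≤ Real.exp 1 := Real.exp_le_exp.2 h1
      have e1 : (1 / 2 : ℝ) ≤ (1 + -z) ^ (-(1 / 4) : ℝ) := by
        calc (1 / 2 : ℝ) = 2 ^ (-1 : ℝ) := by rw [Real.rpow_neg_one]; norm_num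
          _ ≤ 2 ^ (-(1 / 4) : ℝ) := Real.rpow_le_rpow_of_exponent_le (by norm_num) (by norm_num)
          _ ≤ _ := Real.rpow_le_rpow_of_nonpos (by linarith) (by linarith) (by norm_num)
      have e2 : 1 ≤ (1 + -z) ^ (1 / 4 : ℝ) := Real.one_le_rpow (by linarith) (by norm_num)
      have hBe : B * Real.exp (-z) ≤ Real.exp 1 * B := by
        rw [mul_comm]; gcongr
      have hB2 : 0 ≤ Real.exp 1 * B := by positivity
      constructor
      · calc _ ≤ (2 * Real.exp 1 * B) * (1 / 2) := by linarith
          _ ≤ _ := by gcongr; linarith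
      · calc _ ≤ (2 * Real.exp 1 * B) * 1 := by linarith
          _ ≤ _ := by gcongr; linarith

end HNLS

/-! ## The fundamental solution as a function -/

namespace HNLS

/-- `∫ m 𝓕⁻ψ = ∫ 𝓕⁻m ψ` for integrable `m`. -/
theorem integral_mul_fourierInv_eq {m : ℝ → ℂ} (hm : Integrable m) (ψ : 𝓢(ℝ, ℂ)) :
    ∫ η, m η * (𝓕⁻ ψ) η = ∫ x, 𝓕⁻ m x * ψ x := by
  have h := VectorFourier.integral_bilin_fourierIntegral_eq_flip (ContinuousLinearMap.mul ℂ ℂ)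
    (L := innerₗ ℝ) (μ := volume) (ν := volume) Real.continuous_fourierChar continuous_inner
    hm.comp_neg ψ.integrable
  have h1 : ∫ η, m η * (𝓕⁻ ψ) η = ∫ η, m (-η) * 𝓕 (ψ : ℝ → ℂ) η := by
    rw [← integral_neg_eq_self (fun η => m η * (𝓕⁻ ψ : 𝓢(ℝ, ℂ)) η) volume]
    congr 1
    ext η
    rw [SchwartzMap.fourierInv_coe, Real.fourierInv_eq_fourier_neg, neg_neg]
  rw [h1, Real.fourierInv_eq_fourier_comp_neg]
  simpa using! h.symm

/-- The symbol, shifted into the complex plane by `iσ` in the rescaled variable. -/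
noncomputable def dampedSymbol (a b t σ ξ : ℝ) : ℂ :=
  Complex.exp (Complex.I * ((t * ((a / 3) ^ 3 - a * (a / 3) ^ 2 - b * (a / 3))
      - (a ^ 2 / 3 + b) * t * (ξ - a / 3) : ℝ) : ℂ)
    + Complex.I * ((t ^ (1 / 3 : ℝ) * (ξ - a / 3) : ℝ) + σ * Complex.I) ^ 3)

theorem rpow_third_pow {t : ℝ} (ht : 0 ≤ t) : (t ^ (1 / 3 : ℝ)) ^ 3 = t := by
  rw [← Real.rpow_natCast, ← Real.rpow_mul ht]
  norm_num

/-- Taylor expansion of the phase at $\xi=a/3$: the quadratic term disappears, the linear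
coefficient is $-(a^2/3+b)$, and $t$ is absorbed into the cube as $(t^{1/3})^3$. -/
theorem dampedSymbol_zero {t : ℝ} (ht : 0 ≤ t) (a b ξ : ℝ) :
    dampedSymbol a b t 0 ξ = symbol a b t ξ := by
  have h : ((t ^ (1 / 3 : ℝ) : ℝ) : ℂ) ^ 3 = t := by exact_mod_cast rpow_third_pow ht
  rw [dampedSymbol, symbol]
  congr 1
  push_cast
  rw [zero_mul, add_zero, mul_pow, h]
  ring

theorem norm_dampedSymbol (a b t σ ξ : ℝ) :
    ‖dampedSymbol a b t σ ξ‖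
      = Real.exp (-3 * σ * (t ^ (1 / 3 : ℝ) * (ξ - a / 3)) ^ 2 + σ ^ 3) := by
  rw [dampedSymbol, Complex.norm_exp]
  congr 1
  generalize t ^ (1 / 3 : ℝ) * (ξ - a / 3) = s
  generalize t * ((a / 3) ^ 3 - a * (a / 3) ^ 2 - b * (a / 3))
      - (a ^ 2 / 3 + b) * t * (ξ - a / 3) = r
  rw [Complex.add_re]
  have : (Complex.I * (r : ℂ)).re = 0 := by simp
  rw [this]
  simp [pow_succ]
  ring

theorem continuous_dampedSymbol (a b t : ℝ) :
    Continuous fun p : ℝ × ℝ => dampedSymbol a b t p.1 p.2 := by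
  unfold dampedSymbol
  fun_prop

/-- The fundamental solution in terms of the Airy profile. -/
noncomputable def airyKernel (a b t x : ℝ) : ℂ :=
  Complex.exp (Complex.I * ((t * ((a / 3) ^ 3 - a * (a / 3) ^ 2 - b * (a / 3))
      + a / 3 * x : ℝ) : ℂ)) * ((t ^ (1 / 3 : ℝ))⁻¹ : ℝ) *
    airy ((x - (a ^ 2 / 3 + b) * t) / t ^ (1 / 3 : ℝ))

theorem continuous_airyKernel (a b t : ℝ) : Continuous (airyKernel a b t) := by
  unfold airyKernel
  have := continuous_airy
  fun_prop

theorem measurable_airyKernel (a b : ℝ) :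
    Measurable fun p : ℝ × ℝ => airyKernel a b p.1 p.2 := by
  unfold airyKernel
  have := continuous_airy.measurable
  fun_prop

/-- The `x`-derivative of `airyKernel`. -/
noncomputable def airyKernelDeriv (a b t x : ℝ) : ℂ :=
  Complex.exp (Complex.I * ((t * ((a / 3) ^ 3 - a * (a / 3) ^ 2 - b * (a / 3))
      + a / 3 * x : ℝ) : ℂ)) * ((t ^ (1 / 3 : ℝ))⁻¹ : ℝ) *
    (Complex.I * (a / 3 : ℝ) * airy ((x - (a ^ 2 / 3 + b) * t) / t ^ (1 / 3 : ℝ))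
      + ((t ^ (1 / 3 : ℝ))⁻¹ : ℝ) * airyDeriv ((x - (a ^ 2 / 3 + b) * t) / t ^ (1 / 3 : ℝ)))

theorem hasDerivAt_airyKernel (a b t x : ℝ) :
    HasDerivAt (airyKernel a b t) (airyKernelDeriv a b t x) x := by
  have h1 : HasDerivAt (fun x : ℝ => (x - (a ^ 2 / 3 + b) * t) / t ^ (1 / 3 : ℝ))
      (1 / t ^ (1 / 3 : ℝ)) x := ((hasDerivAt_id x).sub_const _).div_const _
  have h2 := (hasDerivAt_airy _).scomp x h1
  have h3 : HasDerivAt (fun x : ℝ => ((t * ((a / 3) ^ 3 - a * (a / 3) ^ 2 - b * (a / 3))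
      + a / 3 * x : ℝ) : ℂ)) ((a / 3 * 1 : ℝ) : ℂ) x :=
    (((hasDerivAt_id x).const_mul (a / 3)).const_add _).ofReal_comp
  have h4 := (((h3.const_mul Complex.I).cexp).mul_const
    (((t ^ (1 / 3 : ℝ))⁻¹ : ℝ) : ℂ)).mul h2
  refine h4.congr_deriv ?_
  simp only [airyKernelDeriv, Function.comp_apply, Complex.real_smul, one_div, mul_one]
  ring

theorem measurable_airyKernelDeriv (a b : ℝ) :
    Measurable fun p : ℝ × ℝ => airyKernelDeriv a b p.1 p.2 := by
  unfold airyKernelDeriv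
  have := continuous_airy.measurable
  have := continuous_airyDeriv.measurable
  fun_prop

theorem integrable_dampedSymbol {t σ : ℝ} (ht : 0 < t) (hσ : 0 < σ) (a b : ℝ) :
    Integrable fun η : ℝ => dampedSymbol a b t σ (2 * Real.pi * η) := by
  have hρ : 0 < t ^ (1 / 3 : ℝ) := by positivity
  have h1 : Integrable fun s : ℝ => Real.exp (-(3 * σ) * s ^ 2) * Real.exp (σ ^ 3) :=
    (integrable_exp_neg_mul_sq (by positivity)).mul_const _
  have hc : t ^ (1 / 3 : ℝ) * (2 * Real.pi) ≠ 0 := by positivity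
  have h2 := (h1.comp_sub_right (t ^ (1 / 3 : ℝ) * (a / 3))).comp_mul_left' hc
  refine h2.mono' (Continuous.aestronglyMeasurable ?_) (ae_of_all _ fun η => ?_)
  · exact (continuous_dampedSymbol a b t).comp (by fun_prop : Continuous fun η : ℝ =>
      (σ, 2 * Real.pi * η))
  · rw [norm_dampedSymbol, ← Real.exp_add]
    refine le_of_eq ?_
    congr 1
    ring

/-- The substitution $s = t^{1/3}(2\pi\eta - a/3)$ reduces this to `integral_exp_cube_eq`. The
constant and linear parts of the phase become the unimodular factor and the drift $(a^2/3+b)t$. -/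
theorem fourierInv_dampedSymbol {t σ : ℝ} (ht : 0 < t) (hσ : 0 < σ) (a b x : ℝ) :
    𝓕⁻ (fun η : ℝ => dampedSymbol a b t σ (2 * Real.pi * η)) x
      = Real.exp (σ * ((x - (a ^ 2 / 3 + b) * t) / t ^ (1 / 3 : ℝ))) * airyKernel a b t x := by
  have hρ : 0 < t ^ (1 / 3 : ℝ) := by positivity
  have h3 : ((t ^ (1 / 3 : ℝ) : ℝ) : ℂ) ^ 3 = t := by exact_mod_cast rpow_third_pow ht.le
  rw [airyKernel]
  set ρ := t ^ (1 / 3 : ℝ) with hρdef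
  have hρ' : (ρ : ℂ) ≠ 0 := by exact_mod_cast hρ.ne'
  have hpi : (Real.pi : ℂ) ≠ 0 := by exact_mod_cast Real.pi_ne_zero
  set z := (x - (a ^ 2 / 3 + b) * t) / ρ with hz
  set E := Complex.exp (Complex.I * ((t * ((a / 3) ^ 3 - a * (a / 3) ^ 2 - b * (a / 3))
      + a / 3 * x : ℝ) : ℂ)) with hE
  set g : ℝ → ℂ := fun s => Complex.exp (Complex.I * ((s : ℂ) + σ * Complex.I) ^ 3
    + Complex.I * z * s) with hg
  rw [Real.fourierInv_eq']
  have key : ∀ η : ℝ, Complex.exp (((2 * Real.pi * inner ℝ η x : ℝ) : ℂ) * Complex.I) •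
      dampedSymbol a b t σ (2 * Real.pi * η) = E * (fun s => g (s - ρ * (a / 3)))
        (ρ * (2 * Real.pi) * η) := by
    intro η
    have hin : inner ℝ η x = x * η := by simp
    rw [hin, smul_eq_mul, dampedSymbol, ← hρdef, hE, hg, ← Complex.exp_add, ← Complex.exp_add, hz]
    congr 1
    have e1 : (((ρ * (2 * Real.pi * η - a / 3) : ℝ) : ℂ))
        = ((ρ * (2 * Real.pi) * η - ρ * (a / 3) : ℝ) : ℂ) := by
      congr 1; ring
    rw [e1]
    generalize hw : Complex.I * (((ρ * (2 * Real.pi) * η - ρ * (a / 3) : ℝ) : ℂ)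
      + σ * Complex.I) ^ 3 = w
    push_cast
    field_simp
    ring
  simp_rw [key]
  rw [integral_const_mul, Measure.integral_comp_mul_left (fun s => g (s - ρ * (a / 3))),
    integral_sub_right_eq_self, integral_exp_cube_eq hσ, abs_of_pos (by positivity)]
  rw [Complex.real_smul]
  push_cast
  field_simp

/-- Supplies the dominating constant for the limit $\sigma\to0$. The restriction $\sigma\le1$
matters because $e^{\sigma z}$ must be beaten by the decay $e^{-z}$ on the right. -/
theorem exists_norm_airyKernel_le {t : ℝ} (ht : 0 < t) (a b : ℝ) :
    ∃ C, ∀ σ ∈ Icc (0 : ℝ) 1, ∀ x, ‖(Real.exp (σ * ((x - (a ^ 2 / 3 + b) * t) / t ^ (1 / 3 : ℝ)))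
      : ℂ) * airyKernel a b t x‖ ≤ C := by
  obtain ⟨A, hA, h1⟩ := exists_norm_airy_le
  obtain ⟨B, hB, h2⟩ := exists_norm_airy_le_exp
  refine ⟨(t ^ (1 / 3 : ℝ))⁻¹ * (A + B), fun σ hσ x => ?_⟩
  rw [airyKernel]
  set z := (x - (a ^ 2 / 3 + b) * t) / t ^ (1 / 3 : ℝ)
  have hz : Real.exp (σ * z) * ‖airy z‖ ≤ A + B := by
    rcases le_total 0 z with h0 | h0
    · calc _ ≤ Real.exp (σ * z) * (B * Real.exp (-z)) := by gcongr; exact (h2 z).1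
        _ = B * Real.exp (σ * z + -z) := by rw [Real.exp_add]; ring
        _ ≤ B * 1 := by
          gcongr
          refine Real.exp_le_one_iff.2 ?_
          nlinarith [hσ.2]
        _ ≤ _ := by linarith
    · have e1 : Real.exp (σ * z) ≤ 1 :=
        Real.exp_le_one_iff.2 (mul_nonpos_of_nonneg_of_nonpos hσ.1 h0)
      have e2 : ‖airy z‖ ≤ A := by
        refine (h1 z).1.trans (mul_le_of_le_one_right hA ?_)
        refine mul_le_one₀ (Real.rpow_le_one_of_one_le_of_nonpos ?_ (by norm_num)) (by positivity)
          (inv_le_one_of_one_le₀ ?_)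
        · linarith [le_max_right (-z) 0]
        · linarith [le_max_right z 0]
      calc _ ≤ 1 * A := by gcongr
        _ ≤ _ := by linarith
  rw [norm_mul, norm_mul, norm_mul, mul_comm Complex.I, Complex.norm_exp_ofReal_mul_I, one_mul,
    Complex.norm_real, Complex.norm_real, Real.norm_eq_abs, Real.norm_eq_abs,
    abs_of_pos (Real.exp_pos _), abs_of_pos (by positivity)]
  calc _ = (t ^ (1 / 3 : ℝ))⁻¹ * (Real.exp (σ * z) * ‖airy z‖) := by ring
    _ ≤ _ := by gcongr

theorem norm_dampedSymbol_le {σ : ℝ} (hσ : σ ∈ Icc (0 : ℝ) 1) (a b t ξ : ℝ) :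
    ‖dampedSymbol a b t σ ξ‖ ≤ Real.exp 1 := by
  rw [norm_dampedSymbol]
  refine Real.exp_le_exp.2 ?_
  have h1 : σ ^ 3 ≤ 1 := pow_le_one₀ hσ.1 hσ.2
  have h2 : 0 ≤ σ * (t ^ (1 / 3 : ℝ) * (ξ - a / 3)) ^ 2 := mul_nonneg hσ.1 (sq_nonneg _)
  linarith

/-- The symbol is not integrable, but the damped one is, so the transform can be moved for
$\sigma>0$. Both sides then converge as $\sigma\downarrow0$ by dominated convergence. -/
theorem integral_symbol_mul_fourierInv {t : ℝ} (ht : 0 < t) (a b : ℝ) (ψ : 𝓢(ℝ, ℂ)) :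
    ∫ η : ℝ, symbol a b t (2 * Real.pi * η) * (𝓕⁻ ψ) η = ∫ x, airyKernel a b t x * ψ x := by
  have hIcc : ∀ᶠ σ : ℝ in 𝓝[>] 0, σ ∈ Ioc (0 : ℝ) 1 :=
    Ioc_mem_nhdsGT one_pos
  have hl : Tendsto (fun σ : ℝ => ∫ η : ℝ, dampedSymbol a b t σ (2 * Real.pi * η) * (𝓕⁻ ψ) η)
      (𝓝[>] 0) (𝓝 (∫ η : ℝ, symbol a b t (2 * Real.pi * η) * (𝓕⁻ ψ) η)) := by
    refine tendsto_integral_filter_of_dominated_convergence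
      (fun η => Real.exp 1 * ‖(𝓕⁻ ψ) η‖) (Eventually.of_forall fun σ => ?_)
      (hIcc.mono fun σ hσ => ae_of_all _ fun η => ?_) ((𝓕⁻ ψ).integrable.norm.const_mul _)
      (ae_of_all _ fun η => ?_)
    · exact (((continuous_dampedSymbol a b t).comp (by fun_prop : Continuous fun η : ℝ =>
        (σ, 2 * Real.pi * η))).mul (𝓕⁻ ψ).continuous).aestronglyMeasurable
    · rw [norm_mul]
      gcongr
      exact norm_dampedSymbol_le ⟨hσ.1.le, hσ.2⟩ a b t _
    · rw [← dampedSymbol_zero ht.le]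
      have : Continuous fun σ : ℝ => dampedSymbol a b t σ (2 * Real.pi * η) * (𝓕⁻ ψ) η :=
        ((continuous_dampedSymbol a b t).comp (by fun_prop : Continuous fun σ : ℝ =>
          (σ, 2 * Real.pi * η))).mul continuous_const
      exact (this.tendsto 0).mono_left nhdsWithin_le_nhds
  obtain ⟨C, hC⟩ := exists_norm_airyKernel_le ht a b
  have hr : Tendsto (fun σ : ℝ => ∫ x : ℝ, (Real.exp (σ * ((x - (a ^ 2 / 3 + b) * t)
      / t ^ (1 / 3 : ℝ))) : ℂ) * airyKernel a b t x * ψ x)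
      (𝓝[>] 0) (𝓝 (∫ x, airyKernel a b t x * ψ x)) := by
    have hc := continuous_airyKernel a b t
    refine tendsto_integral_filter_of_dominated_convergence
      (fun η => C * ‖ψ η‖) (Eventually.of_forall fun σ => ?_)
      (hIcc.mono fun σ hσ => ae_of_all _ fun η => ?_) (ψ.integrable.norm.const_mul _)
      (ae_of_all _ fun x => ?_)
    · have := ψ.continuous
      exact (by fun_prop : Continuous fun x : ℝ => (Real.exp (σ * ((x - (a ^ 2 / 3 + b) * t)
      / t ^ (1 / 3 : ℝ))) : ℂ) * airyKernel a b t x * ψ x).aestronglyMeasurable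
    · rw [norm_mul]
      gcongr
      exact hC σ ⟨hσ.1.le, hσ.2⟩ _
    · have : Continuous fun σ : ℝ => (Real.exp (σ * ((x - (a ^ 2 / 3 + b) * t)
        / t ^ (1 / 3 : ℝ))) : ℂ) * airyKernel a b t x * ψ x := by fun_prop
      simpa using (this.tendsto 0).mono_left nhdsWithin_le_nhds
  refine tendsto_nhds_unique hl (hr.congr' (hIcc.mono fun σ hσ => ?_))
  beta_reduce
  rw [integral_mul_fourierInv_eq (integrable_dampedSymbol ht hσ.1 a b)]
  simp_rw [fourierInv_dampedSymbol ht hσ.1]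

theorem fundamentalDistribution_apply (a b t : ℝ) (ψ : 𝓢(ℝ, ℂ)) :
    fundamentalDistribution a b t ψ
      = ∫ η : ℝ, symbol a b t (2 * Real.pi * η) * (𝓕⁻ ψ) η := by
  rw [fundamentalDistribution, TemperedDistribution.fourierInv_apply,
    Lp.toTemperedDistribution_apply]
  refine integral_congr_ae ?_
  filter_upwards [(memLp_symbol a b t).coeFn_toLp] with η hη
  rw [hη, smul_eq_mul, mul_comm]

theorem isTemperedGivenBy_airyKernel {t : ℝ} (ht : 0 < t) (a b : ℝ) :
    IsTemperedGivenBy (fundamentalDistribution a b t) (airyKernel a b t) := by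
  intro ψ
  refine ⟨?_, by rw [fundamentalDistribution_apply, integral_symbol_mul_fourierInv ht]⟩
  obtain ⟨C, hC⟩ := exists_norm_airyKernel_le ht a b
  refine ψ.integrable.bdd_mul (c := C) (continuous_airyKernel a b t).aestronglyMeasurable
    (ae_of_all _ fun x => ?_)
  simpa using hC 0 ⟨le_rfl, zero_le_one⟩ x

/-- Smooth compactly supported functions are Schwartz functions, so the difference vanishes almost
everywhere, and by continuity everywhere. -/
theorem IsTemperedGivenBy.eq_of_continuous {V : 𝓢'(ℝ, ℂ)} {g₁ g₂ : ℝ → ℂ}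
    (h₁ : IsTemperedGivenBy V g₁) (h₂ : IsTemperedGivenBy V g₂) (c₁ : Continuous g₁)
    (c₂ : Continuous g₂) : g₁ = g₂ := by
  have h : ∀ᵐ x, (g₁ - g₂) x = 0 := by
    refine ae_eq_zero_of_integral_contDiff_smul_eq_zero (c₁.sub c₂).locallyIntegrable ?_
    intro g g_smooth g_cpt
    have hg₁ : HasCompactSupport (Complex.ofRealCLM ∘ g) := g_cpt.comp_left rfl
    have hg₂ : ContDiff ℝ (⊤ : ℕ∞) (Complex.ofRealCLM ∘ g) := by fun_prop
    obtain ⟨i1, e1⟩ := h₁ (hg₁.toSchwartzMap hg₂)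
    obtain ⟨i2, e2⟩ := h₂ (hg₁.toSchwartzMap hg₂)
    have : ∀ x, g x • (g₁ - g₂) x = g₁ x * hg₁.toSchwartzMap hg₂ x
        - g₂ x * hg₁.toSchwartzMap hg₂ x := fun x => by
      simp
      ring
    simp_rw [this]
    rw [integral_sub i1 i2, ← e1, ← e2, sub_self]
  exact Continuous.ae_eq_iff_eq volume c₁ c₂ |>.1
    (h.mono fun x hx => sub_eq_zero.1 hx)

/-- `G` is a chosen continuous representative. Uniqueness of such representatives pins the choice
down. -/
theorem G_eq_airyKernel {t : ℝ} (ht : 0 < t) (a b : ℝ) : G a b t = airyKernel a b t := by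
  have h : 0 < t ∧ ∃ g : ℝ → ℂ, Continuous g ∧
      IsTemperedGivenBy (fundamentalDistribution a b t) g :=
    ⟨ht, _, continuous_airyKernel a b t, isTemperedGivenBy_airyKernel ht a b⟩
  have : G a b t = Classical.choose h.2 := by
    ext x
    rw [G, dif_pos h]
  rw [this]
  exact (Classical.choose_spec h.2).2.eq_of_continuous (isTemperedGivenBy_airyKernel ht a b)
    (Classical.choose_spec h.2).1 (continuous_airyKernel a b t)

theorem Gx_eq_airyKernelDeriv {t : ℝ} (ht : 0 < t) (a b : ℝ) :
    Gx a b t = airyKernelDeriv a b t := by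
  ext x
  rw [Gx, G_eq_airyKernel ht, (hasDerivAt_airyKernel a b t x).deriv]

end HNLS

/-! ## Bounds for the kernels -/

namespace HNLS

/-- The weight `(1 + y₊)^{-1/4} (1 + y₋)⁻¹`, which dominates the kernel `G(t, x - ·)`. -/
noncomputable def leftWeight (y : ℝ) : ℝ := (1 + max y 0) ^ (-(1 / 4) : ℝ) * (1 + max (-y) 0)⁻¹

/-- The weight `(1 + y₊)^{1/4}`, which dominates the kernel `G_x(t, x - ·)`. -/
noncomputable def rightWeight (y : ℝ) : ℝ := (1 + max y 0) ^ (1 / 4 : ℝ)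

theorem one_le_one_add_max (y : ℝ) : 1 ≤ 1 + max y 0 := by linarith [le_max_right y 0]

theorem leftWeight_pos (y : ℝ) : 0 < leftWeight y := by
  have h1 := one_le_one_add_max y
  have h2 := one_le_one_add_max (-y)
  exact mul_pos (Real.rpow_pos_of_pos (by linarith) _) (inv_pos.2 (by linarith))

theorem one_le_rightWeight (y : ℝ) : 1 ≤ rightWeight y :=
  Real.one_le_rpow (one_le_one_add_max y) (by norm_num)

theorem leftWeight_le_one (y : ℝ) : leftWeight y ≤ 1 := by
  have h1 := one_le_one_add_max y
  have h2 := one_le_one_add_max (-y)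
  exact mul_le_one₀ (Real.rpow_le_one_of_one_le_of_nonpos h1 (by norm_num))
    (inv_nonneg.2 (by linarith)) (inv_le_one_of_one_le₀ h2)

theorem continuous_leftWeight : Continuous leftWeight := by
  unfold leftWeight
  refine Continuous.mul (Continuous.rpow_const (by fun_prop) fun y => Or.inl ?_)
    (Continuous.inv₀ (by fun_prop) fun y => ?_)
  · linarith [one_le_one_add_max y]
  · linarith [one_le_one_add_max (-y)]

theorem continuous_rightWeight : Continuous rightWeight := by
  unfold rightWeight
  exact Continuous.rpow_const (by fun_prop) fun y => Or.inr (by norm_num)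

/-- Integrability against `leftWeight` therefore implies growth of order one in the mean, which is
enough to define a functional. -/
theorem inv_one_add_abs_le_leftWeight (y : ℝ) : (1 + |y|)⁻¹ ≤ leftWeight y := by
  unfold leftWeight
  rcases le_total 0 y with h | h
  · rw [max_eq_left h, max_eq_right (by linarith), abs_of_nonneg h, add_zero, inv_one, mul_one,
      ← Real.rpow_neg_one]
    exact Real.rpow_le_rpow_of_exponent_le (by linarith) (by norm_num)
  · rw [max_eq_right h, max_eq_left (by linarith), abs_of_nonpos h, add_zero, Real.one_rpow,
      one_mul]

/-- Transfers weights from the scaled variable $z$ to $y$, with $\rho=t^{1/3}$ and drift $k=\kappa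
t$ in mind. The shift by $x$ costs a factor linear in $|x|$. Only the last bound, going from $z$
back to $y$, costs $1/\rho$. -/
theorem one_add_max_le_of_eq {R K ρ x y z k : ℝ} (hρ : 0 < ρ) (hR : 1 ≤ R) (hρR : ρ ≤ R)
    (hk : |k| + 1 ≤ K) (hz : x - y - k = ρ * z) :
    1 + max y 0 ≤ R * K * (1 + |x|) * (1 + max (-z) 0) ∧
      1 + max (-y) 0 ≤ R * K * (1 + |x|) * (1 + max z 0) ∧
      1 + max (-z) 0 ≤ R * K * (1 + |x|) * (1 + max y 0) / ρ := by
  have x0 := abs_nonneg x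
  have hK : 1 ≤ K := by linarith [abs_nonneg k]
  have x1 := le_abs_self x
  have x2 := neg_abs_le x
  have k1 := le_abs_self k
  have k2 := neg_abs_le k
  have hKx : 1 + |x| + |k| ≤ K * (1 + |x|) := by nlinarith [abs_nonneg k]
  have hKx1 : 1 ≤ K * (1 + |x|) := by linarith [abs_nonneg k]
  have aux : ∀ m w : ℝ, 0 ≤ m → w ≤ ρ * m + |x| + |k| →
      1 + w ≤ R * K * (1 + |x|) * (1 + m) := by
    intro m w hm hw
    have h1 : ρ * m ≤ R * m := by gcongr
    have h2 : R * m ≤ R * (K * (1 + |x|)) * m := by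
      have : R ≤ R * (K * (1 + |x|)) := le_mul_of_one_le_right (by linarith) hKx1
      gcongr
    have h3 : K * (1 + |x|) ≤ R * (K * (1 + |x|)) := le_mul_of_one_le_left (by linarith) hR
    calc 1 + w ≤ R * (K * (1 + |x|)) + R * (K * (1 + |x|)) * m := by linarith
      _ = _ := by ring
  have m1 := le_max_left z 0
  have m2 := le_max_right z 0
  have m3 := le_max_left (-z) 0
  have m4 := le_max_right (-z) 0
  have y1 := le_max_left y 0
  have y2 := le_max_right y 0
  refine ⟨aux _ _ m4 ?_, aux _ _ m2 ?_, ?_⟩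
  · have : 0 ≤ ρ * max (-z) 0 := by positivity
    refine max_le ?_ (by linarith [abs_nonneg k])
    nlinarith
  · have : 0 ≤ ρ * max z 0 := by positivity
    refine max_le ?_ (by linarith [abs_nonneg k])
    nlinarith
  · rw [le_div_iff₀ hρ, add_mul, one_mul]
    have h1 : max (-z) 0 * ρ ≤ max y 0 + |x| + |k| := by
      rw [max_mul_of_nonneg _ _ hρ.le]
      exact max_le (by linarith) (by linarith [abs_nonneg k])
    have h2 : R * 1 ≤ R * (K * (1 + |x|)) := by gcongr
    have h3 : 1 * max y 0 ≤ K * (1 + |x|) * max y 0 := by gcongr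
    have h4 : 1 * (K * (1 + |x|) * (1 + max y 0)) ≤ R * (K * (1 + |x|) * (1 + max y 0)) := by
      gcongr
    have h5 : (|x| + |k|) ≤ K * (1 + |x|) - 1 := by linarith
    by_cases hρ1 : ρ ≤ 1
    · calc ρ + max (-z) 0 * ρ ≤ 1 * (K * (1 + |x|) * (1 + max y 0)) := by linarith
        _ ≤ R * (K * (1 + |x|) * (1 + max y 0)) := h4
        _ = _ := by ring
    · have h6 : 0 ≤ (R - 1) * (K * (1 + |x|) - 1) :=
        mul_nonneg (by linarith) (by linarith)
      have h7 : 0 ≤ (R - 1) * (K * (1 + |x|) * max y 0) :=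
        mul_nonneg (by linarith) (by positivity)
      calc ρ + max (-z) 0 * ρ ≤ R * (K * (1 + |x|)) + R * (K * (1 + |x|) * max y 0) := by
            linarith
        _ = _ := by ring

/-- Decay of the profile loses no power of $\rho$. Growth of its derivative loses $\rho^{-1/4}$,
because $(1+z_-)^{1/4}$ is compared with $((1+y_+)/\rho)^{1/4}$. -/
theorem exists_norm_airy_le_weight :
    ∃ A, 0 ≤ A ∧ ∀ {R K ρ x y z k : ℝ}, 0 < ρ → 1 ≤ R → ρ ≤ R → |k| + 1 ≤ K →
      x - y - k = ρ * z →
      ‖airy z‖ ≤ A * ((R * K * (1 + |x|)) ^ 2 * leftWeight y) ∧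
      ‖airyDeriv z‖ ≤ A * (R * K * (1 + |x|) * rightWeight y * ρ ^ (-(1 / 4) : ℝ)) := by
  obtain ⟨A, hA, hairy⟩ := exists_norm_airy_le
  refine ⟨A, hA, fun {R K ρ x y z k} hρ0 hR1 hρR hk hz => ?_⟩
  obtain ⟨e1, e2, e3⟩ := one_add_max_le_of_eq (x := x) (y := y) (z := z) hρ0 hR1 hρR hk hz
  have hK1 : 1 ≤ K := by linarith [abs_nonneg k]
  have hL1 : 1 ≤ R * K * (1 + |x|) :=
    one_le_mul_of_one_le_of_one_le (one_le_mul_of_one_le_of_one_le hR1 hK1)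
      (by linarith [abs_nonneg x])
  generalize R * K * (1 + |x|) = L at e1 e2 e3 hL1 ⊢
  have p1 := one_le_one_add_max y
  have p2 := one_le_one_add_max (-y)
  have p3 := one_le_one_add_max z
  have p4 := one_le_one_add_max (-z)
  have hL4 : L ^ (1 / 4 : ℝ) ≤ L := by
    simpa using Real.rpow_le_rpow_of_exponent_le hL1 (by norm_num : (1 / 4 : ℝ) ≤ 1)
  have f1 : (1 + max (-z) 0) ^ (-(1 / 4) : ℝ) ≤ L * (1 + max y 0) ^ (-(1 / 4) : ℝ) := by
    have q1 : 0 < (1 + max y 0) ^ (1 / 4 : ℝ) := Real.rpow_pos_of_pos (by linarith) _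
    have q2 : 0 < (1 + max (-z) 0) ^ (1 / 4 : ℝ) := Real.rpow_pos_of_pos (by linarith) _
    rw [Real.rpow_neg (by linarith), Real.rpow_neg (by linarith), ← div_eq_mul_inv,
      le_div_iff₀ q1, inv_mul_le_iff₀ q2]
    calc (1 + max y 0) ^ (1 / 4 : ℝ) ≤ (L * (1 + max (-z) 0)) ^ (1 / 4 : ℝ) :=
          Real.rpow_le_rpow (by linarith) e1 (by norm_num)
      _ = L ^ (1 / 4 : ℝ) * (1 + max (-z) 0) ^ (1 / 4 : ℝ) :=
          Real.mul_rpow (by linarith) (by linarith)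
      _ ≤ L * (1 + max (-z) 0) ^ (1 / 4 : ℝ) := by gcongr
      _ = _ := mul_comm _ _
  have f2 : (1 + max z 0)⁻¹ ≤ L * (1 + max (-y) 0)⁻¹ := by
    rw [← div_eq_mul_inv, le_div_iff₀ (by linarith), inv_mul_le_iff₀ (by linarith)]
    linarith
  have f3 : (1 + max (-z) 0) ^ (1 / 4 : ℝ) ≤ L * rightWeight y * ρ ^ (-(1 / 4) : ℝ) := by
    calc _ ≤ (L * (1 + max y 0) / ρ) ^ (1 / 4 : ℝ) :=
          Real.rpow_le_rpow (by linarith) e3 (by norm_num)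
      _ = L ^ (1 / 4 : ℝ) * (1 + max y 0) ^ (1 / 4 : ℝ) * ρ ^ (-(1 / 4) : ℝ) := by
          rw [Real.div_rpow (mul_nonneg (by linarith) (by linarith)) hρ0.le,
            Real.mul_rpow (by linarith) (by linarith), div_eq_mul_inv, Real.rpow_neg hρ0.le]
      _ ≤ _ := by unfold rightWeight; gcongr
  have f4 : (1 + max (-z) 0) ^ (-(1 / 4) : ℝ) * (1 + max z 0)⁻¹ ≤ L ^ 2 * leftWeight y := by
    calc _ ≤ (L * (1 + max y 0) ^ (-(1 / 4) : ℝ)) * (L * (1 + max (-y) 0)⁻¹) :=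
          mul_le_mul f1 f2 (inv_nonneg.2 (by linarith)) (mul_nonneg (by linarith)
            (Real.rpow_nonneg (by linarith) _))
      _ = _ := by unfold leftWeight; ring
  exact ⟨(hairy z).1.trans (mul_le_mul_of_nonneg_left f4 hA),
    (hairy z).2.trans (mul_le_mul_of_nonneg_left f3 hA)⟩

theorem norm_airyKernel (a b : ℝ) {t : ℝ} (ht : 0 < t) (x : ℝ) :
    ‖airyKernel a b t x‖ = (t ^ (1 / 3 : ℝ))⁻¹ *
      ‖airy ((x - (a ^ 2 / 3 + b) * t) / t ^ (1 / 3 : ℝ))‖ := by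
  rw [airyKernel, norm_mul, norm_mul, mul_comm Complex.I, Complex.norm_exp_ofReal_mul_I, one_mul,
    Complex.norm_real, Real.norm_eq_abs, abs_of_pos (by positivity)]

theorem norm_airyKernelDeriv_le (a b : ℝ) {t : ℝ} (ht : 0 < t) (x : ℝ) :
    ‖airyKernelDeriv a b t x‖ ≤ |a / 3| * ((t ^ (1 / 3 : ℝ))⁻¹ *
      ‖airy ((x - (a ^ 2 / 3 + b) * t) / t ^ (1 / 3 : ℝ))‖) +
      (t ^ (1 / 3 : ℝ))⁻¹ * ((t ^ (1 / 3 : ℝ))⁻¹ *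
      ‖airyDeriv ((x - (a ^ 2 / 3 + b) * t) / t ^ (1 / 3 : ℝ))‖) := by
  have h0 : 0 < (t ^ (1 / 3 : ℝ))⁻¹ := by positivity
  rw [airyKernelDeriv, norm_mul, norm_mul, mul_comm Complex.I, Complex.norm_exp_ofReal_mul_I,
    one_mul, Complex.norm_real, Real.norm_eq_abs, abs_of_pos h0]
  generalize (t ^ (1 / 3 : ℝ))⁻¹ = r at h0
  generalize airy ((x - (a ^ 2 / 3 + b) * t) / t ^ (1 / 3 : ℝ)) = u
  generalize airyDeriv ((x - (a ^ 2 / 3 + b) * t) / t ^ (1 / 3 : ℝ)) = v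
  have n1 : ‖Complex.I * ((a / 3 : ℝ) : ℂ) * u + ((r : ℝ) : ℂ) * v‖
      ≤ |a / 3| * ‖u‖ + r * ‖v‖ := by
    refine (norm_add_le _ _).trans (le_of_eq ?_)
    rw [norm_mul, norm_mul, norm_mul, Complex.norm_I, one_mul, Complex.norm_real,
      Complex.norm_real, Real.norm_eq_abs, Real.norm_eq_abs, abs_of_pos h0]
  calc _ ≤ r * (|a / 3| * ‖u‖ + r * ‖v‖) := by gcongr
    _ = _ := by ring

/-- Bounds for the kernels `G(t, x - y)` and `G_x(t, x - y)`, uniform on `(0, T]`. -/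
theorem exists_norm_airyKernel_sub_le (a b : ℝ) {T : ℝ} (hT : 0 < T) :
    ∃ C, 0 ≤ C ∧ ∀ t ∈ Ioc 0 T, ∀ x y : ℝ,
      ‖airyKernel a b t (x - y)‖ ≤ C * t ^ (-(3 / 4) : ℝ) * (1 + |x|) ^ 2 * leftWeight y ∧
      ‖airyKernelDeriv a b t (x - y)‖
        ≤ C * t ^ (-(3 / 4) : ℝ) * (1 + |x|) ^ 2 * rightWeight y := by
  obtain ⟨A, hA, hairy⟩ := exists_norm_airy_le_weight
  set κ := a ^ 2 / 3 + b with hκ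
  obtain ⟨R, hR⟩ : ∃ R, R = 1 + T ^ (1 / 3 : ℝ) := ⟨_, rfl⟩
  obtain ⟨K, hK⟩ : ∃ K, K = 1 + |κ| * T := ⟨_, rfl⟩
  have hTp : 0 < T ^ (1 / 3 : ℝ) := by positivity
  have hR1 : 1 ≤ R := by linarith
  have hκT : 0 ≤ |κ| * T := by positivity
  have hK1 : 1 ≤ K := by linarith
  -- Since $t^{-1/3}=t^{5/12}t^{-3/4}$, this constant lets $G$ share the singularity $t^{-3/4}$ of
  -- $G_x$.
  obtain ⟨D, hD⟩ : ∃ D, D = T ^ (5 / 12 : ℝ) := ⟨_, rfl⟩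
  have hD0 : 0 < D := by rw [hD]; positivity
  refine ⟨D * A * (R * K) ^ 2 + (|a / 3| * (D * A * (R * K) ^ 2) + A * (R * K)), by positivity,
    fun t ht x y => ?_⟩
  have ht0 : 0 < t := ht.1
  have hN := norm_airyKernel a b ht0 (x - y)
  have hN' := norm_airyKernelDeriv_le a b ht0 (x - y)
  obtain ⟨ρ, hρ⟩ : ∃ ρ, ρ = t ^ (1 / 3 : ℝ) := ⟨_, rfl⟩
  have hρ0 : 0 < ρ := by rw [hρ]; positivity
  have hρR : ρ ≤ R := by
    have : ρ ≤ T ^ (1 / 3 : ℝ) := hρ ▸ Real.rpow_le_rpow ht0.le ht.2 (by norm_num)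
    linarith
  rw [← hρ, ← hκ] at hN hN'
  have hk : |κ * t| + 1 ≤ K := by
    rw [abs_mul, abs_of_pos ht0, hK]
    have : |κ| * t ≤ |κ| * T := by gcongr; exact ht.2
    linarith
  obtain ⟨g1, g2⟩ := hairy (x := x) (y := y) (z := (x - y - κ * t) / ρ) hρ0 hR1 hρR hk
    (by field_simp)
  generalize airy ((x - y - κ * t) / ρ) = u at hN hN' g1
  generalize airyDeriv ((x - y - κ * t) / ρ) = v at hN' g2
  have r1 : ρ⁻¹ ≤ D * t ^ (-(3 / 4) : ℝ) := by
    have h : ρ⁻¹ = t ^ (5 / 12 : ℝ) * t ^ (-(3 / 4) : ℝ) := by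
      rw [hρ, ← Real.rpow_neg ht0.le, ← Real.rpow_add ht0]
      norm_num
    have h' : t ^ (5 / 12 : ℝ) ≤ D := hD ▸ Real.rpow_le_rpow ht0.le ht.2 (by norm_num)
    rw [h]
    gcongr
  -- The origin of the exponent: $-\tfrac13-\tfrac13-\tfrac1{12}=-\tfrac34$.
  have r2 : ρ⁻¹ * ρ⁻¹ * ρ ^ (-(1 / 4) : ℝ) = t ^ (-(3 / 4) : ℝ) := by
    rw [hρ, ← Real.rpow_mul ht0.le, ← Real.rpow_neg ht0.le, ← Real.rpow_add ht0,
      ← Real.rpow_add ht0]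
    norm_num
  have tp : 0 < t ^ (-(3 / 4) : ℝ) := by positivity
  have w1 := leftWeight_pos y
  have w2 : leftWeight y ≤ rightWeight y := (leftWeight_le_one y).trans (one_le_rightWeight y)
  have x1 : 1 + |x| ≤ (1 + |x|) ^ 2 := le_self_pow₀ (by linarith [abs_nonneg x]) two_ne_zero
  generalize t ^ (-(3 / 4) : ℝ) = τ at *
  generalize leftWeight y = l at *
  generalize rightWeight y = r at *
  have hr : 0 < r := w1.trans_le w2
  have b1 : ρ⁻¹ * ‖u‖ ≤ D * A * (R * K) ^ 2 * (τ * (1 + |x|) ^ 2 * l) := by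
    calc _ ≤ D * τ * (A * ((R * K * (1 + |x|)) ^ 2 * l)) := by gcongr
      _ = _ := by ring
  have b2 : ρ⁻¹ * (ρ⁻¹ * ‖v‖) ≤ A * (R * K) * (τ * (1 + |x|) ^ 2 * r) := by
    calc _ ≤ ρ⁻¹ * (ρ⁻¹ * (A * (R * K * (1 + |x|) * r * ρ ^ (-(1 / 4) : ℝ)))) := by gcongr
      _ = A * (R * K) * ((ρ⁻¹ * ρ⁻¹ * ρ ^ (-(1 / 4) : ℝ)) * (1 + |x|) * r) := by ring
      _ = A * (R * K) * (τ * (1 + |x|) * r) := by rw [r2]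
      _ ≤ _ := by gcongr
  have b3 : |a / 3| * (ρ⁻¹ * ‖u‖) ≤ |a / 3| * (D * A * (R * K) ^ 2 * (τ * (1 + |x|) ^ 2 * r)) :=
    mul_le_mul_of_nonneg_left (b1.trans (by gcongr)) (abs_nonneg _)
  have c1 : 0 ≤ (|a / 3| * (D * A * (R * K) ^ 2) + A * (R * K)) * (τ * (1 + |x|) ^ 2 * l) := by
    positivity
  have c2 : 0 ≤ D * A * (R * K) ^ 2 * (τ * (1 + |x|) ^ 2 * r) := by positivity
  constructor
  · rw [hN]
    calc _ ≤ D * A * (R * K) ^ 2 * (τ * (1 + |x|) ^ 2 * l) +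
          (|a / 3| * (D * A * (R * K) ^ 2) + A * (R * K)) * (τ * (1 + |x|) ^ 2 * l) :=
          b1.trans (le_add_of_nonneg_right c1)
      _ = _ := by ring
  · calc _ ≤ D * A * (R * K) ^ 2 * (τ * (1 + |x|) ^ 2 * r) +
          (|a / 3| * (D * A * (R * K) ^ 2 * (τ * (1 + |x|) ^ 2 * r)) +
            A * (R * K) * (τ * (1 + |x|) ^ 2 * r)) :=
          (hN'.trans (add_le_add b3 b2)).trans (le_add_of_nonneg_left c2)
      _ = _ := by ring

end HNLS

/-! ## Functionals given by functions -/

namespace HNLS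

/-- A seminorm on the Schwartz space controlling `(1 + |x|)^N |ψ(x)|`. -/
noncomputable def decaySeminorm (N : ℕ) (ψ : 𝓢(ℝ, ℂ)) : ℝ :=
  2 ^ N * (SchwartzMap.seminorm ℂ 0 0 ψ + SchwartzMap.seminorm ℂ N 0 ψ)

theorem continuous_decaySeminorm (N : ℕ) : Continuous (decaySeminorm N) := by
  have h : ∀ k : ℕ, Continuous fun ψ : 𝓢(ℝ, ℂ) => SchwartzMap.seminorm ℂ k 0 ψ := fun k =>
    (schwartz_withSeminorms ℂ ℝ ℂ).continuous_seminorm (k, 0)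
  unfold decaySeminorm
  exact ((h 0).add (h N)).const_mul _

theorem decaySeminorm_zero (N : ℕ) : decaySeminorm N 0 = 0 := by
  simp [decaySeminorm]

theorem pow_mul_norm_le_decaySeminorm (N : ℕ) (ψ : 𝓢(ℝ, ℂ)) (x : ℝ) :
    (1 + |x|) ^ N * ‖ψ x‖ ≤ decaySeminorm N ψ := by
  have h0 := SchwartzMap.norm_le_seminorm ℂ ψ x
  have h1 := SchwartzMap.norm_pow_mul_le_seminorm ℂ ψ N x
  have h2 : (1 + |x|) ^ N ≤ 2 ^ N * (1 + |x| ^ N) := by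
    refine (add_pow_le zero_le_one (abs_nonneg x) N).trans ?_
    rw [one_pow]
    gcongr
    · norm_num
    · exact Nat.sub_le N 1
  rw [Real.norm_eq_abs] at h1
  calc _ ≤ 2 ^ N * (1 + |x| ^ N) * ‖ψ x‖ := by gcongr
    _ = 2 ^ N * (‖ψ x‖ + |x| ^ N * ‖ψ x‖) := by ring
    _ ≤ _ := by unfold decaySeminorm; gcongr

theorem one_add_abs_pos (x : ℝ) : 0 < 1 + |x| := by linarith [abs_nonneg x]

theorem norm_mul_le_of_decaySeminorm {N : ℕ} (ψ : 𝓢(ℝ, ℂ)) (x : ℝ) (c : ℂ) :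
    ‖c * ψ x‖ ≤ ‖(((1 + |x|) ^ N)⁻¹ : ℝ) • c‖ * decaySeminorm N ψ := by
  have h := pow_mul_norm_le_decaySeminorm N ψ x
  have hx : 0 < (1 + |x|) ^ N := pow_pos (one_add_abs_pos x) N
  rw [norm_mul, norm_smul, Real.norm_eq_abs, abs_of_pos (inv_pos.2 hx)]
  calc ‖c‖ * ‖ψ x‖ = ((1 + |x|) ^ N)⁻¹ * ‖c‖ * ((1 + |x|) ^ N * ‖ψ x‖) := by field_simp
    _ ≤ _ := by gcongr

theorem continuous_inv_pow (N : ℕ) : Continuous fun x : ℝ => ((1 + |x|) ^ N)⁻¹ :=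
  Continuous.inv₀ (by fun_prop) fun x => (pow_pos (one_add_abs_pos x) N).ne'

theorem aestronglyMeasurable_of_smul {α : Type*} [MeasurableSpace α] {μ : Measure α} {w : α → ℝ}
    {f : α → ℂ} (hw : Measurable w) (h0 : ∀ x, w x ≠ 0)
    (h : AEStronglyMeasurable (fun x => w x • f x) μ) : AEStronglyMeasurable f μ := by
  refine (hw.inv.aestronglyMeasurable.smul h).congr (ae_of_all _ fun x => ?_)
  change (w x)⁻¹ • w x • f x = f x
  rw [smul_smul, inv_mul_cancel₀ (h0 x), one_smul]

/-- A function of at most polynomial growth in the mean defines a tempered distribution. -/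
theorem exists_isTemperedGivenBy {g : ℝ → ℂ} {N : ℕ}
    (hg : Integrable fun x : ℝ => (((1 + |x|) ^ N)⁻¹ : ℝ) • g x) :
    ∃ V : 𝓢'(ℝ, ℂ), IsTemperedGivenBy V g := by
  have hm : AEStronglyMeasurable g volume := aestronglyMeasurable_of_smul
    (continuous_inv_pow N).measurable
    (fun x => (inv_pos.2 (pow_pos (one_add_abs_pos x) N)).ne') hg.aestronglyMeasurable
  have hi : ∀ ψ : 𝓢(ℝ, ℂ), Integrable fun x => g x * ψ x := fun ψ =>
    (hg.norm.mul_const (decaySeminorm N ψ)).mono' (hm.mul ψ.continuous.aestronglyMeasurable)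
      (ae_of_all _ fun x => norm_mul_le_of_decaySeminorm ψ x (g x))
  let L : 𝓢(ℝ, ℂ) →ₗ[ℂ] ℂ :=
    { toFun := fun ψ => ∫ x, g x * ψ x
      map_add' := fun ψ χ => by
        rw [← integral_add (hi ψ) (hi χ)]
        simp [mul_add]
      map_smul' := fun c ψ => by
        rw [RingHom.id_apply, smul_eq_mul, ← integral_const_mul]
        congr 1
        ext x
        simp
        ring }
  have hL : Continuous L := by
    refine continuous_of_continuousAt_zero L ?_
    rw [ContinuousAt, map_zero, tendsto_zero_iff_norm_tendsto_zero]
    have hz : Tendsto (fun ψ => (∫ x, ‖(((1 + |x|) ^ N)⁻¹ : ℝ) • g x‖) * decaySeminorm N ψ) (𝓝 0)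
        (𝓝 0) := by
      simpa [decaySeminorm_zero] using
        ((continuous_decaySeminorm N).const_mul (∫ x, ‖(((1 + |x|) ^ N)⁻¹ : ℝ) • g x‖)).tendsto 0
    refine squeeze_zero (fun _ => norm_nonneg _) (fun ψ => ?_) hz
    rw [← integral_mul_const]
    exact norm_integral_le_of_norm_le (hg.norm.mul_const _)
      (ae_of_all _ fun x => norm_mul_le_of_decaySeminorm ψ x (g x))
  exact ⟨ContinuousLinearMap.toPointwiseConvergenceCLM _ _ _ _ ⟨L, hL⟩, fun ψ => ⟨hi ψ, rfl⟩⟩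

variable {T : ℝ}

/-- The value at `(t, x)` of a continuous curve in the Schwartz space, extended to all times by
its end values. -/
noncomputable def curveEval (hT : 0 ≤ T) (Φ : C(Icc (0 : ℝ) T, 𝓢(ℝ, ℂ))) (t x : ℝ) : ℂ :=
  Φ (projIcc 0 T hT t) x

theorem continuous_schwartz_eval :
    Continuous fun p : 𝓢(ℝ, ℂ) × ℝ => p.1 p.2 := by
  have h : Continuous fun p : 𝓢(ℝ, ℂ) × ℝ =>
      (SchwartzMap.toBoundedContinuousFunctionCLM ℂ ℝ ℂ p.1) p.2 :=
    continuous_eval.comp (((SchwartzMap.toBoundedContinuousFunctionCLM ℂ ℝ ℂ).continuous.comp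
      continuous_fst).prodMk continuous_snd)
  exact h

theorem continuous_curveEval (hT : 0 ≤ T) (Φ : C(Icc (0 : ℝ) T, 𝓢(ℝ, ℂ))) :
    Continuous fun p : ℝ × ℝ => curveEval hT Φ p.1 p.2 :=
  continuous_schwartz_eval.comp
    ((Φ.continuous.comp (continuous_projIcc.comp continuous_fst)).prodMk continuous_snd)

theorem evalAt_eq_curveEval (hT : 0 ≤ T) (φ : TestSpace T) {t : ℝ} (ht : t ∈ Icc 0 T) (x : ℝ) :
    evalAt φ t x = curveEval hT (φ.1 0) t x := by
  rw [evalAt, dif_pos ht, curveEval, projIcc_of_mem hT ht, valueAt]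

theorem exists_decaySeminorm_le (N : ℕ) (Φ : C(Icc (0 : ℝ) T, 𝓢(ℝ, ℂ))) :
    ∃ C, 0 ≤ C ∧ ∀ t, decaySeminorm N (Φ t) ≤ C := by
  obtain ⟨C, hC⟩ := (isCompact_range
    ((continuous_decaySeminorm N).comp Φ.continuous)).bddAbove
  exact ⟨max C 0, le_max_right _ _, fun t => (hC ⟨t, rfl⟩).trans (le_max_left _ _)⟩

theorem measurableSet_strip (T : ℝ) : MeasurableSet (strip T) :=
  measurableSet_Ioo.prod MeasurableSet.univ

/-- A function on the strip of at most polynomial growth in the mean defines a functional. -/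
theorem exists_isGivenBy (hT : 0 < T) {f : ℝ → ℝ → ℂ} {N : ℕ}
    (hf : IntegrableOn (fun p : ℝ × ℝ => (((1 + |p.2|) ^ N)⁻¹ : ℝ) • f p.1 p.2) (strip T)) :
    ∃ F : DualSpace T, IsGivenBy F f := by
  have hm : AEStronglyMeasurable (fun p : ℝ × ℝ => f p.1 p.2) (volume.restrict (strip T)) :=
    aestronglyMeasurable_of_smul (w := fun p : ℝ × ℝ => ((1 + |p.2|) ^ N)⁻¹)
      ((continuous_inv_pow N).measurable.comp measurable_snd)
      (fun x => (inv_pos.2 (pow_pos (one_add_abs_pos _) N)).ne') hf.aestronglyMeasurable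
  have hφm : ∀ φ : TestSpace T, AEStronglyMeasurable (fun p : ℝ × ℝ => evalAt φ p.1 p.2)
      (volume.restrict (strip T)) := fun φ => by
    refine (continuous_curveEval hT.le (φ.1 0)).aestronglyMeasurable.congr ?_
    filter_upwards [ae_restrict_mem (measurableSet_strip T)] with p hp
    rw [evalAt_eq_curveEval hT.le φ (Ioo_subset_Icc_self hp.1)]
  have hbd : ∀ (φ : TestSpace T) (C : ℝ), (∀ t, decaySeminorm N (φ.1 0 t) ≤ C) →
      ∀ᵐ p ∂(volume.restrict (strip T)), ‖f p.1 p.2 * evalAt φ p.1 p.2‖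
        ≤ ‖(((1 + |p.2|) ^ N)⁻¹ : ℝ) • f p.1 p.2‖ * C := fun φ C hC => by
    filter_upwards [ae_restrict_mem (measurableSet_strip T)] with p hp
    rw [evalAt_eq_curveEval hT.le φ (Ioo_subset_Icc_self hp.1), curveEval]
    refine (norm_mul_le_of_decaySeminorm (N := N) _ _ _).trans ?_
    gcongr
    exact hC _
  have hi : ∀ φ : TestSpace T,
      IntegrableOn (fun p : ℝ × ℝ => f p.1 p.2 * evalAt φ p.1 p.2) (strip T) := fun φ => by
    obtain ⟨C, -, hC⟩ := exists_decaySeminorm_le N (φ.1 0)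
    exact (hf.norm.mul_const C).mono' (hm.mul (hφm φ)) (hbd φ C hC)
  let L : TestSpace T →ₗ[ℂ] ℂ :=
    { toFun := fun φ => ∫ p in strip T, f p.1 p.2 * evalAt φ p.1 p.2
      map_add' := fun φ χ => by
        rw [← integral_add (hi φ) (hi χ)]
        refine setIntegral_congr_fun (measurableSet_strip T) fun p hp => ?_
        simp only [evalAt, dif_pos (Ioo_subset_Icc_self hp.1)]
        simp [valueAt, mul_add]
      map_smul' := fun c φ => by
        rw [RingHom.id_apply, smul_eq_mul, ← integral_const_mul]
        refine setIntegral_congr_fun (measurableSet_strip T) fun p hp => ?_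
        simp only [evalAt, dif_pos (Ioo_subset_Icc_self hp.1)]
        simp [valueAt]
        ring }
  have hL : Continuous L := by
    refine continuous_of_continuousAt_zero L ?_
    rw [ContinuousAt, map_zero, Metric.tendsto_nhds]
    intro ε hε
    set I := ∫ p in strip T, ‖(((1 + |p.2|) ^ N)⁻¹ : ℝ) • f p.1 p.2‖ with hI
    have hI0 : 0 ≤ I := by positivity
    set δ := ε / (I + 1) with hδ
    have hδ0 : 0 < δ := by positivity
    -- As $[0,T]$ is compact, uniform smallness of a Schwartz seminorm along the curve is an open
    -- condition. Only the zeroth time derivative is needed for continuity.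
    have hopen : IsOpen {Φ : C(Icc (0 : ℝ) T, 𝓢(ℝ, ℂ)) |
        MapsTo Φ univ {ψ | decaySeminorm N ψ < δ}} :=
      ContinuousMap.isOpen_setOfPred_mapsTo isCompact_univ
        (isOpen_lt (continuous_decaySeminorm N) continuous_const)
    have hcont : Continuous fun φ : TestSpace T => φ.1 0 :=
      (continuous_apply 0).comp continuous_subtype_val
    have hmem : ∀ᶠ φ : TestSpace T in 𝓝 0, MapsTo (φ.1 0) univ {ψ | decaySeminorm N ψ < δ} := by
      refine (hopen.preimage hcont).mem_nhds ?_
      intro t _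
      simpa [decaySeminorm_zero] using hδ0
    filter_upwards [hmem] with φ hφ
    rw [dist_zero_right]
    calc ‖L φ‖ ≤ ∫ p in strip T, ‖(((1 + |p.2|) ^ N)⁻¹ : ℝ) • f p.1 p.2‖ * δ :=
          norm_integral_le_of_norm_le (hf.norm.mul_const δ)
            (hbd φ δ fun t => (show decaySeminorm N (φ.1 0 t) < δ from hφ (mem_univ t)).le)
      _ = I * δ := by rw [integral_mul_const]
      _ < ε := by
          rw [hδ, mul_div_assoc', div_lt_iff₀ (by positivity)]
          nlinarith
  exact ⟨⟨L, hL⟩, fun φ => ⟨hi φ, rfl⟩⟩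

end HNLS

/-! ## Weighted spaces -/

namespace HNLS

theorem continuous_one_add_max_rpow (α : ℝ) : Continuous fun y : ℝ => (1 + max y 0) ^ α :=
  Continuous.rpow_const (by fun_prop) fun y => Or.inl (by linarith [one_le_one_add_max y])

theorem one_add_max_rpow_pos (α y : ℝ) : 0 < (1 + max y 0) ^ α :=
  Real.rpow_pos_of_pos (by linarith [one_le_one_add_max y]) _

/-- The square is $(1+y)^{-1-2\varepsilon}$ on the right and $(1+|y|)^{-2}$ on the left. The minimum
with $1/2$ gives one exponent above $1$ valid on both sides. -/
theorem memLp_leftWeight_mul {ε : ℝ} (hε : 0 < ε) :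
    MemLp (fun y => leftWeight y * (1 + max y 0) ^ (-(1 / 4 + ε))) 2 volume := by
  have hc : Continuous fun y => leftWeight y * (1 + max y 0) ^ (-(1 / 4 + ε)) :=
    continuous_leftWeight.mul (continuous_one_add_max_rpow _)
  rw [memLp_two_iff_integrable_sq hc.aestronglyMeasurable]
  have hr : (Module.finrank ℝ ℝ : ℝ) < 1 + 2 * min ε (1 / 2) := by
    have : 0 < min ε (1 / 2) := lt_min hε (by norm_num)
    rw [Module.finrank_self, Nat.cast_one]
    linarith
  refine (integrable_one_add_norm (E := ℝ) (μ := volume) hr).mono' (hc.pow 2).aestronglyMeasurable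
    (ae_of_all _ fun y => ?_)
  rw [Real.norm_eq_abs, abs_of_nonneg (sq_nonneg _), leftWeight, Real.norm_eq_abs]
  rcases le_total 0 y with h | h
  · rw [max_eq_left h, max_eq_right (by linarith), abs_of_nonneg h, add_zero, inv_one, mul_one,
      ← Real.rpow_add (by linarith), ← Real.rpow_natCast, ← Real.rpow_mul (by linarith)]
    refine Real.rpow_le_rpow_of_exponent_le (by linarith) ?_
    push_cast
    linarith [min_le_left ε (1 / 2)]
  · rw [max_eq_right h, max_eq_left (by linarith), abs_of_nonpos h, add_zero, Real.one_rpow,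
      Real.one_rpow, one_mul, mul_one, ← Real.rpow_neg_one, ← Real.rpow_natCast,
      ← Real.rpow_mul (by linarith)]
    refine Real.rpow_le_rpow_of_exponent_le (by linarith) ?_
    push_cast
    linarith [min_le_right ε (1 / 2)]

theorem leftWeight_smul_eq (ε y : ℝ) (c : ℂ) : leftWeight y • c
    = (leftWeight y * (1 + max y 0) ^ (-(1 / 4 + ε))) • (1 + max y 0) ^ (1 / 4 + ε) • c := by
  rw [smul_smul, mul_assoc, ← Real.rpow_add (by linarith [one_le_one_add_max y]),
    neg_add_cancel, Real.rpow_zero, mul_one]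

/-- Cauchy–Schwarz against the square-integrable quotient of the two weights. -/
theorem MemWeightedLp.integrable_leftWeight {ε : ℝ} (hε : 0 < ε) {u : ℝ → ℂ}
    (hu : MemWeightedLp (1 / 4 + ε) 2 u) : Integrable fun y => leftWeight y • u y := by
  have h : MemLp ((fun y => leftWeight y * (1 + max y 0) ^ (-(1 / 4 + ε))) •
      fun y => (1 + max y 0) ^ (1 / 4 + ε) • u y) 1 volume :=
    MemLp.smul (p := 2) (q := 2) (r := 1) hu (memLp_leftWeight_mul hε)
  rw [memLp_one_iff_integrable] at h
  exact h.congr (ae_of_all _ fun y => (leftWeight_smul_eq ε y (u y)).symm)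

theorem volume_restrict_strip (T : ℝ) : (volume : Measure (ℝ × ℝ)).restrict (strip T)
    = (volume.restrict (Ioo 0 T)).prod volume := by
  rw [strip, Measure.volume_eq_prod, ← Measure.prod_restrict, Measure.restrict_univ]

theorem integrableOn_strip_of_lintegral {T : ℝ} {w : ℝ → ℝ} (hw : Continuous w)
    {f : ℝ → ℝ → ℂ}
    (hm : AEStronglyMeasurable (Function.uncurry f) (volume.restrict (strip T)))
    (h : ∫⁻ t in Ioo 0 T, eLpNorm (fun x => w x • f t x) 1 volume < ∞) :
    IntegrableOn (fun p : ℝ × ℝ => w p.2 • f p.1 p.2) (strip T) := by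
  have hm' : AEStronglyMeasurable (fun p : ℝ × ℝ => w p.2 • f p.1 p.2)
      (volume.restrict (strip T)) :=
    (hw.comp continuous_snd).aestronglyMeasurable.smul hm
  refine ⟨hm', ?_⟩
  rw [volume_restrict_strip] at hm' ⊢
  rw [HasFiniteIntegral, lintegral_prod _ hm'.enorm]
  simpa only [eLpNorm_one_eq_lintegral_enorm] using h

theorem eLpNorm_leftWeight_smul_le {ε : ℝ} (hε : 0 < ε) {u : ℝ → ℂ}
    (hu : AEStronglyMeasurable u volume) :
    eLpNorm (fun y => leftWeight y • u y) 1 volume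
      ≤ eLpNorm (fun y => leftWeight y * (1 + max y 0) ^ (-(1 / 4 + ε))) 2 volume *
        eLpNorm (fun y => (1 + max y 0) ^ (1 / 4 + ε) • u y) 2 volume := by
  have hu' : AEStronglyMeasurable (fun y => (1 + max y 0) ^ (1 / 4 + ε) • u y) volume :=
    (continuous_one_add_max_rpow _).aestronglyMeasurable.smul hu
  have he : (fun y => leftWeight y • u y)
      = (fun y => leftWeight y * (1 + max y 0) ^ (-(1 / 4 + ε))) •
        fun y => (1 + max y 0) ^ (1 / 4 + ε) • u y :=
    funext fun y => leftWeight_smul_eq ε y (u y)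
  rw [he]
  exact eLpNorm_smul_le_mul_eLpNorm (p := 2) (q := 2) (r := 1) hu' (memLp_leftWeight_mul hε).1

theorem MemL1WeightedLp.integrableOn_leftWeight {T ε : ℝ} (hε : 0 < ε) {f : ℝ → ℝ → ℂ}
    (hf : MemL1WeightedLp T (1 / 4 + ε) 2 f) :
    IntegrableOn (fun p : ℝ × ℝ => leftWeight p.2 • f p.1 p.2) (strip T) := by
  refine integrableOn_strip_of_lintegral continuous_leftWeight hf.1 ?_
  have hsl : ∀ᵐ t ∂(volume.restrict (Ioo 0 T)), AEStronglyMeasurable (fun x => f t x) volume := by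
    have hm := hf.1
    rw [volume_restrict_strip] at hm
    exact hm.prodMk_left
  refine (lintegral_mono_ae (hsl.mono fun t ht => eLpNorm_leftWeight_smul_le hε ht)).trans_lt ?_
  rw [lintegral_const_mul' _ _ (memLp_leftWeight_mul hε).2.ne]
  exact ENNReal.mul_lt_top (memLp_leftWeight_mul hε).2 hf.2

theorem MemL1WeightedLp.integrableOn {T α : ℝ} {f : ℝ → ℝ → ℂ} (hf : MemL1WeightedLp T α 1 f) :
    IntegrableOn (fun p : ℝ × ℝ => (1 + max p.2 0) ^ α • f p.1 p.2) (strip T) :=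
  integrableOn_strip_of_lintegral (continuous_one_add_max_rpow α) hf.1 hf.2

theorem integrable_smul_of_le {α : Type*} [MeasurableSpace α] {μ : Measure α}
    {w v : α → ℝ} {f : α → ℂ} (h : Integrable (fun x => v x • f x) μ) (hw : Measurable w)
    (hv : Measurable v) (h0 : ∀ x, 0 ≤ w x) (hwv : ∀ x, w x ≤ v x) (hpos : ∀ x, 0 < v x) :
    Integrable (fun x => w x • f x) μ := by
  have hm := aestronglyMeasurable_of_smul hv (fun x => (hpos x).ne') h.aestronglyMeasurable
  refine h.mono (hw.aestronglyMeasurable.smul hm) (ae_of_all _ fun x => ?_)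
  rw [norm_smul, norm_smul, Real.norm_eq_abs, Real.norm_eq_abs, abs_of_nonneg (h0 x),
    abs_of_pos (hpos x)]
  gcongr
  exact hwv x

theorem MemL1WeightedLp.integrableOn_leftWeight_of_one {T : ℝ} {f : ℝ → ℝ → ℂ}
    (hf : MemL1WeightedLp T (-(1 / 4)) 1 f) :
    IntegrableOn (fun p : ℝ × ℝ => leftWeight p.2 • f p.1 p.2) (strip T) := by
  refine integrable_smul_of_le hf.integrableOn
    (continuous_leftWeight.measurable.comp measurable_snd)
    ((continuous_one_add_max_rpow _).measurable.comp measurable_snd)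
    (fun p => (leftWeight_pos _).le) (fun p => ?_) (fun p => one_add_max_rpow_pos _ _)
  exact mul_le_of_le_one_right (one_add_max_rpow_pos _ _).le
    (inv_le_one_of_one_le₀ (one_le_one_add_max _))

end HNLS

/-! ## Potentials of kernels with an integrable singularity in time -/

namespace HNLS

/-- One half of Schur's test: a uniform bound on the $p$-integrals of the kernel and an integrable
density give joint integrability by Tonelli. -/
theorem integrable_mul_prod_of_integral_norm_le {α β : Type*} [MeasurableSpace α]
    [MeasurableSpace β] {ν : Measure α} {μ : Measure β} [SFinite ν] [SFinite μ] {A : α × β → ℝ}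
    (hA : Measurable A) {F : β → ℝ} (hF : Integrable F μ) {M : ℝ}
    (h₁ : ∀ q, Integrable (fun p => A (p, q)) ν) (h₂ : ∀ q, ∫ p, ‖A (p, q)‖ ∂ν ≤ M) :
    Integrable (fun z => A z * F z.2) (ν.prod μ) := by
  have hm : AEStronglyMeasurable (fun z : α × β => A z * F z.2) (ν.prod μ) :=
    hA.aestronglyMeasurable.mul hF.aestronglyMeasurable.comp_snd
  rw [integrable_prod_iff' hm]
  refine ⟨ae_of_all _ fun q => (h₁ q).mul_const (F q), ?_⟩
  refine (hF.norm.const_mul M).mono' hm.norm.prod_swap.integral_prod_right'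
    (ae_of_all _ fun q => ?_)
  simp_rw [norm_mul]
  rw [integral_mul_const, Real.norm_eq_abs, abs_of_nonneg (by positivity)]
  exact mul_le_mul_of_nonneg_right (h₂ q) (norm_nonneg _)

/-- The singularity `s^{-3/4}` of the kernels in time, cut off to `(0, T)`. -/
noncomputable def timeSingularity (T : ℝ) : ℝ → ℝ := (Ioo 0 T).indicator fun s => s ^ (-(3 / 4) : ℝ)

theorem measurable_timeSingularity (T : ℝ) : Measurable (timeSingularity T) :=
  (by fun_prop : Measurable fun s : ℝ => s ^ (-(3 / 4) : ℝ)).indicator measurableSet_Ioo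

theorem timeSingularity_nonneg (T s : ℝ) : 0 ≤ timeSingularity T s :=
  indicator_nonneg (fun _ hs => Real.rpow_nonneg hs.1.le _) s

theorem integrable_timeSingularity (T : ℝ) : Integrable (timeSingularity T) := by
  rw [timeSingularity, integrable_indicator_iff measurableSet_Ioo]
  by_cases hT : 0 ≤ T
  · have h : IntervalIntegrable (fun s : ℝ => s ^ (-(3 / 4) : ℝ)) volume 0 T :=
      intervalIntegral.intervalIntegrable_rpow' (by norm_num)
    rw [intervalIntegrable_iff_integrableOn_Ioo_of_le hT] at h
    exact h
  · rw [Ioo_eq_empty (by linarith)]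
    exact integrableOn_empty

/-- A convolution kernel with the bounds enjoyed by `G` and `G_x`. -/
structure IsBoundedKernel (T C : ℝ) (ω : ℝ → ℝ) (k : ℝ → ℝ → ℂ) : Prop where
  measurable : Measurable (Function.uncurry k)
  measurable_weight : Measurable ω
  weight_pos : ∀ y, 0 < ω y
  nonneg : 0 ≤ C
  bound : ∀ t ∈ Ioc 0 T, ∀ x y, ‖k t (x - y)‖ ≤ C * t ^ (-(3 / 4) : ℝ) * (1 + |x|) ^ 2 * ω y

open Classical in
/-- The kernel `θ(t - τ) k(t - τ, x - y)`. -/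
noncomputable def retardedKernel (k : ℝ → ℝ → ℂ) (p q : ℝ × ℝ) : ℂ :=
  if q.1 < p.1 then k (p.1 - q.1) (p.2 - q.2) else 0

theorem measurable_retardedKernel {k : ℝ → ℝ → ℂ} (hk : Measurable (Function.uncurry k)) :
    Measurable fun z : (ℝ × ℝ) × (ℝ × ℝ) => retardedKernel k z.1 z.2 := by
  refine Measurable.ite (measurableSet_lt (by fun_prop) (by fun_prop)) ?_ measurable_const
  exact hk.comp (by fun_prop : Measurable fun z : (ℝ × ℝ) × (ℝ × ℝ) =>
    (z.1.1 - z.2.1, z.1.2 - z.2.2))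

section Potential

variable {T C : ℝ} {ω : ℝ → ℝ} {k : ℝ → ℝ → ℂ}

/-- When the kernel is nonzero, the conditions on $p$ and $q$ force $0<p_1-q_1<T$, so the cutoff in
`timeSingularity` is not felt. -/
theorem IsBoundedKernel.norm_retardedKernel_le (hk : IsBoundedKernel T C ω k) {p q : ℝ × ℝ}
    (hp : p.1 < T) (hq : 0 ≤ q.1) :
    ‖retardedKernel k p q‖ ≤ C * timeSingularity T (p.1 - q.1) * (1 + |p.2|) ^ 2 * ω q.2 := by
  have hC := hk.nonneg
  have hω := hk.weight_pos q.2
  have hs := timeSingularity_nonneg T (p.1 - q.1)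
  unfold retardedKernel
  split_ifs with h
  · rw [timeSingularity, indicator_of_mem (mem_Ioo.2 ⟨by linarith, by linarith⟩)]
    exact hk.bound _ ⟨by linarith, by linarith⟩ _ _
  · rw [norm_zero]
    positivity

theorem integrable_inv_sq_pow : Integrable fun x : ℝ => ((1 + |x|) ^ 2)⁻¹ := by
  have h := integrable_one_add_norm (E := ℝ) (μ := volume) (r := 2) (by simp)
  refine h.congr (ae_of_all _ fun x => ?_)
  simp only [Real.norm_eq_abs]
  rw [Real.rpow_neg (one_add_abs_pos x).le]
  norm_num

theorem integrable_timeSingularity_mul (T τ : ℝ) :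
    Integrable fun p : ℝ × ℝ => timeSingularity T (p.1 - τ) * ((1 + |p.2|) ^ 2)⁻¹ :=
  ((integrable_timeSingularity T).comp_sub_right τ).mul_prod integrable_inv_sq_pow

/-- The potential of the density `f` with respect to the measure `m`. -/
noncomputable def potential (k : ℝ → ℝ → ℂ) (m : Measure (ℝ × ℝ)) (f : ℝ × ℝ → ℂ) (p : ℝ × ℝ) : ℂ :=
  ∫ q, retardedKernel k p q * f q ∂m

variable {m : Measure (ℝ × ℝ)} {f : ℝ × ℝ → ℂ}

theorem IsBoundedKernel.aestronglyMeasurable_density (hk : IsBoundedKernel T C ω k)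
    (hf : Integrable (fun q => ω q.2 • f q) m) : AEStronglyMeasurable f m :=
  aestronglyMeasurable_of_smul (w := fun q : ℝ × ℝ => ω q.2)
    (hk.measurable_weight.comp measurable_snd) (fun q => (hk.weight_pos q.2).ne')
    hf.aestronglyMeasurable

/-- The decay of order $4$ of $\varphi$ offsets the growth $(1+|x|)^2$ of the kernel and leaves the
integrable $(1+|x|)^{-2}$. The measure $m$ is kept general in order to cover both sources on the
strip and data concentrated on $t=0$. -/
theorem IsBoundedKernel.integrable_prod [SFinite m] (hk : IsBoundedKernel T C ω k)
    (hf : Integrable (fun q => ω q.2 • f q) m) (hm : ∀ᵐ q ∂m, 0 ≤ q.1)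
    {φ : ℝ × ℝ → ℂ} {B : ℝ} (hφm : AEStronglyMeasurable φ (volume.restrict (strip T)))
    (hφ : ∀ᵐ p ∂(volume.restrict (strip T)), ‖φ p‖ ≤ B * ((1 + |p.2|) ^ 4)⁻¹) :
    Integrable (fun z : (ℝ × ℝ) × (ℝ × ℝ) => retardedKernel k z.1 z.2 * f z.2 * φ z.1)
      ((volume.restrict (strip T)).prod m) := by
  have hfm := hk.aestronglyMeasurable_density hf
  have hA : Measurable fun z : (ℝ × ℝ) × (ℝ × ℝ) =>
      timeSingularity T (z.1.1 - z.2.1) * ((1 + |z.1.2|) ^ 2)⁻¹ :=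
    ((measurable_timeSingularity T).comp (by fun_prop)).mul
      ((continuous_inv_pow 2).measurable.comp (by fun_prop))
  have hb := ((integrable_mul_prod_of_integral_norm_le (ν := volume.restrict (strip T)) hA hf.norm
    (M := (∫ s, timeSingularity T s) * ∫ x : ℝ, ((1 + |x|) ^ 2)⁻¹)
    (fun q => (integrable_timeSingularity_mul T q.1).restrict) fun q => ?_)).const_mul (C * B)
  · refine hb.mono' (((measurable_retardedKernel hk.measurable).aestronglyMeasurable.mul
      hfm.comp_snd).mul hφm.comp_fst) ?_
    have h1 : ∀ᵐ z ∂((volume.restrict (strip T)).prod m),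
        ‖φ z.1‖ ≤ B * ((1 + |z.1.2|) ^ 4)⁻¹ ∧ z.1 ∈ strip T :=
      Measure.quasiMeasurePreserving_fst.ae (hφ.and (ae_restrict_mem (measurableSet_strip T)))
    have h2 : ∀ᵐ z ∂((volume.restrict (strip T)).prod m), 0 ≤ z.2.1 :=
      Measure.quasiMeasurePreserving_snd.ae hm
    filter_upwards [h1, h2] with z hz1 hz2
    have hω := hk.weight_pos z.2.2
    have hx := one_add_abs_pos z.1.2
    rw [norm_mul, norm_mul, norm_smul, Real.norm_eq_abs, abs_of_pos hω]
    have hn := hk.norm_retardedKernel_le (hz1.2.1.2) hz2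
    calc _ ≤ C * timeSingularity T (z.1.1 - z.2.1) * (1 + |z.1.2|) ^ 2 * ω z.2.2 * ‖f z.2‖ *
          (B * ((1 + |z.1.2|) ^ 4)⁻¹) := by
          have := norm_nonneg (φ z.1)
          gcongr
          · exact mul_nonneg ((norm_nonneg _).trans hn) (norm_nonneg _)
          · exact hz1.1
      _ = _ := by
          field_simp
  · have hn : ∀ p : ℝ × ℝ, ‖timeSingularity T (p.1 - q.1) * ((1 + |p.2|) ^ 2)⁻¹‖
        = timeSingularity T (p.1 - q.1) * ((1 + |p.2|) ^ 2)⁻¹ := fun p => by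
      rw [Real.norm_eq_abs, abs_of_nonneg (mul_nonneg (timeSingularity_nonneg _ _) (by positivity))]
    simp only [hn]
    refine (setIntegral_le_integral (integrable_timeSingularity_mul T q.1) (ae_of_all _ fun p =>
      mul_nonneg (timeSingularity_nonneg _ _) (by positivity))).trans (le_of_eq ?_)
    rw [Measure.volume_eq_prod, integral_prod_mul (fun t => timeSingularity T (t - q.1))
        (fun x : ℝ => ((1 + |x|) ^ 2)⁻¹), integral_sub_right_eq_self]

/-- Fubini moves the kernel from the density onto the test function. This is the duality on which
the weak formulation rests. -/
theorem IsBoundedKernel.integrable_potential_mul [SFinite m] (hk : IsBoundedKernel T C ω k)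
    (hf : Integrable (fun q => ω q.2 • f q) m) (hm : ∀ᵐ q ∂m, 0 ≤ q.1)
    {φ : ℝ × ℝ → ℂ} {B : ℝ} (hφm : AEStronglyMeasurable φ (volume.restrict (strip T)))
    (hφ : ∀ᵐ p ∂(volume.restrict (strip T)), ‖φ p‖ ≤ B * ((1 + |p.2|) ^ 4)⁻¹) :
    IntegrableOn (fun p => potential k m f p * φ p) (strip T) ∧
      ∫ p in strip T, potential k m f p * φ p
        = ∫ q, f q * (∫ p in strip T, retardedKernel k p q * φ p) ∂m := by
  have h := hk.integrable_prod hf hm hφm hφ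
  have e : ∀ p, (∫ q, retardedKernel k p q * f q * φ p ∂m) = potential k m f p * φ p := fun p => by
    rw [integral_mul_const, potential]
  refine ⟨?_, ?_⟩
  · have h' := h.integral_prod_left
    simp only [e] at h'
    exact h'
  · have h' := integral_integral_swap (f := fun p q => retardedKernel k p q * f q * φ p) h
    simp only [e] at h'
    rw [h']
    refine integral_congr_ae (ae_of_all _ fun q => ?_)
    beta_reduce
    rw [← integral_const_mul]
    congr 1
    ext p
    ring

theorem IsBoundedKernel.integrableOn_inv_pow_smul_potential [SFinite m] (hk : IsBoundedKernel T C ω k)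
    (hf : Integrable (fun q => ω q.2 • f q) m) (hm : ∀ᵐ q ∂m, 0 ≤ q.1) :
    IntegrableOn (fun p : ℝ × ℝ => (((1 + |p.2|) ^ 4)⁻¹ : ℝ) • potential k m f p) (strip T) := by
  have hc : Continuous fun p : ℝ × ℝ => ((((1 + |p.2|) ^ 4)⁻¹ : ℝ) : ℂ) :=
    Complex.continuous_ofReal.comp ((continuous_inv_pow 4).comp continuous_snd)
  -- The weight $(1+|x|)^{-4}$ itself serves as the test function.
  refine (hk.integrable_potential_mul hf hm (B := 1) hc.aestronglyMeasurable
    (ae_of_all _ fun p => ?_)).1.congr (ae_of_all _ fun p => ?_)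
  · have := one_add_abs_pos p.2
    rw [Complex.norm_real, Real.norm_eq_abs, abs_of_pos (by positivity), one_mul]
  · simp only [Complex.real_smul, mul_comm]

/-- For almost every `t` the potential converges absolutely at all points `(t, x)`. -/
theorem IsBoundedKernel.ae_forall_integrable [SFinite m] (hk : IsBoundedKernel T C ω k)
    (hf : Integrable (fun q => ω q.2 • f q) m) (hm : ∀ᵐ q ∂m, 0 ≤ q.1) :
    ∀ᵐ t ∂(volume.restrict (Ioo 0 T)), ∀ x,
      Integrable (fun q => retardedKernel k (t, x) q * f q) m := by
  have hA : Measurable fun z : ℝ × (ℝ × ℝ) => timeSingularity T (z.1 - z.2.1) :=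
    (measurable_timeSingularity T).comp (by fun_prop)
  -- The kernel bound depends on $x$ only through $(1+|x|)^2$. Tonelli in $t$ alone therefore gives
  -- an exceptional null set of times independent of $x$.
  have hb := integrable_mul_prod_of_integral_norm_le (ν := volume) hA hf.norm
    (M := ∫ s, ‖timeSingularity T s‖)
    (fun q => (integrable_timeSingularity T).comp_sub_right q.1) fun q => le_of_eq
      (integral_sub_right_eq_self (fun s => ‖timeSingularity T s‖) q.1)
  filter_upwards [ae_restrict_of_ae hb.prod_right_ae, ae_restrict_mem measurableSet_Ioo]
    with t ht htT x
  refine (ht.const_mul (C * (1 + |x|) ^ 2)).mono' ?_ ?_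
  · exact ((measurable_retardedKernel hk.measurable).comp
      (measurable_prodMk_left (x := (t, x)))).aestronglyMeasurable.mul
      (hk.aestronglyMeasurable_density hf)
  · filter_upwards [hm] with q hq
    have hω := hk.weight_pos q.2
    have hn := hk.norm_retardedKernel_le (p := (t, x)) htT.2 hq
    rw [norm_mul, norm_smul, Real.norm_eq_abs, abs_of_pos hω]
    calc _ ≤ C * timeSingularity T (t - q.1) * (1 + |x|) ^ 2 * ω q.2 * ‖f q‖ := by gcongr
      _ = _ := by ring

end Potential

end HNLS

/-! ## The adjoint equation on the Fourier side -/

namespace HNLS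

/-- The value of the inverse Fourier transform at a point. -/
noncomputable def fourierInvAt (η : ℝ) : 𝓢(ℝ, ℂ) →L[ℂ] ℂ :=
  (BoundedContinuousFunction.evalCLM ℂ η).comp
    ((SchwartzMap.toBoundedContinuousFunctionCLM ℂ ℝ ℂ).comp
      (FourierTransform.fourierInvCLM ℂ 𝓢(ℝ, ℂ)))

theorem fourierInvAt_apply (η : ℝ) (ψ : 𝓢(ℝ, ℂ)) : fourierInvAt η ψ = (𝓕⁻ ψ) η := rfl

theorem fourierInvAt_derivCLM (η : ℝ) (ψ : 𝓢(ℝ, ℂ)) :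
    fourierInvAt η (SchwartzMap.derivCLM ℂ ℂ ψ)
      = -(2 * Real.pi * Complex.I * η) * fourierInvAt η ψ := by
  have h := Real.fourier_deriv ψ.integrable ψ.differentiable
    (SchwartzMap.derivCLM ℂ ℂ ψ).integrable
  have h' := congrFun h (-η)
  rw [fourierInvAt_apply, fourierInvAt_apply, SchwartzMap.fourierInv_coe,
    SchwartzMap.fourierInv_coe, Real.fourierInv_eq_fourier_neg, Real.fourierInv_eq_fourier_neg]
  refine h'.trans ?_
  rw [smul_eq_mul]
  push_cast
  ring

theorem fourierInv_translate (ψ : 𝓢(ℝ, ℂ)) (y η : ℝ) :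
    fourierInvAt η (SchwartzMap.compSubConstCLM ℂ (-y) ψ)
      = Complex.exp (-(2 * Real.pi * η * y : ℝ) * Complex.I) * fourierInvAt η ψ := by
  rw [fourierInvAt_apply, fourierInvAt_apply, SchwartzMap.fourierInv_coe,
    SchwartzMap.fourierInv_coe, Real.fourierInv_eq', Real.fourierInv_eq', ← integral_const_mul,
    ← integral_sub_right_eq_self _ y]
  congr 1
  ext v
  rw [SchwartzMap.compSubConstCLM_apply, smul_eq_mul, smul_eq_mul, ← mul_assoc, ← Complex.exp_add]
  congr 2
  · simp
    ring
  · ring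

/-- Convolution with the fundamental solution on the Fourier side. -/
theorem integral_airyKernel_sub_mul {s : ℝ} (hs : 0 < s) (a b y : ℝ) (ψ : 𝓢(ℝ, ℂ)) :
    ∫ x, airyKernel a b s (x - y) * ψ x = ∫ η : ℝ, symbol a b s (2 * Real.pi * η) *
      (Complex.exp (-(2 * Real.pi * η * y : ℝ) * Complex.I) * fourierInvAt η ψ) := by
  rw [← integral_add_right_eq_self _ y]
  have h := integral_symbol_mul_fourierInv hs a b (SchwartzMap.compSubConstCLM ℂ (-y) ψ)
  simp_rw [← fourierInvAt_apply, fourierInv_translate] at h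
  rw [h]
  simp

theorem integral_exp_mul_fourierInvAt (y : ℝ) (ψ : 𝓢(ℝ, ℂ)) :
    ∫ η : ℝ, Complex.exp (-(2 * Real.pi * η * y : ℝ) * Complex.I) * fourierInvAt η ψ = ψ y := by
  have h : 𝓕 (𝓕⁻ ψ) y = ψ y := by rw [FourierTransform.fourier_fourierInv_eq]
  rw [← h, SchwartzMap.fourier_coe, Real.fourier_eq']
  congr 1
  ext η
  rw [smul_eq_mul, fourierInvAt_apply]
  congr 2
  simp
  ring

theorem norm_symbol (a b t ξ : ℝ) : ‖symbol a b t ξ‖ = 1 := by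
  rw [symbol, mul_comm, Complex.norm_exp_ofReal_mul_I]

theorem continuous_symbol (a b : ℝ) : Continuous fun p : ℝ × ℝ => symbol a b p.1 p.2 := by
  unfold symbol
  fun_prop

theorem symbol_zero (a b ξ : ℝ) : symbol a b 0 ξ = 1 := by
  simp [symbol]

theorem hasDerivAt_symbol (a b t ξ : ℝ) : HasDerivAt (fun t => symbol a b t ξ)
    (Complex.I * (ξ ^ 3 - a * ξ ^ 2 - b * ξ : ℝ) * symbol a b t ξ) t := by
  have h : HasDerivAt (fun t : ℝ => ((t * (ξ ^ 3 - a * ξ ^ 2 - b * ξ) : ℝ) : ℂ))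
      ((1 * (ξ ^ 3 - a * ξ ^ 2 - b * ξ) : ℝ) : ℂ) t :=
    ((hasDerivAt_id t).mul_const _).ofReal_comp
  refine (h.const_mul Complex.I).cexp.congr_deriv ?_
  rw [symbol, one_mul]
  ring

variable {T : ℝ}

/-- The formal adjoint operator of the equation, applied to a test function. -/
noncomputable def adjointOp (a b : ℝ) (φ : TestSpace T) : TestSpace T :=
  Complex.I • timeDeriv φ - (a : ℂ) • spaceDeriv (spaceDeriv φ)
    + (Complex.I * b) • spaceDeriv φ + Complex.I • spaceDeriv (spaceDeriv (spaceDeriv φ))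

theorem spaceDeriv_apply (φ : TestSpace T) (j : ℕ) (t : Icc (0 : ℝ) T) :
    (spaceDeriv φ).1 j t = SchwartzMap.derivCLM ℂ ℂ (φ.1 j t) := rfl

theorem adjointOp_apply (a b : ℝ) (φ : TestSpace T) (j : ℕ) (t : Icc (0 : ℝ) T) :
    (adjointOp a b φ).1 j t = Complex.I • φ.1 (j + 1) t
      - (a : ℂ) • SchwartzMap.derivCLM ℂ ℂ (SchwartzMap.derivCLM ℂ ℂ (φ.1 j t))
      + (Complex.I * b) • SchwartzMap.derivCLM ℂ ℂ (φ.1 j t)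
      + Complex.I • SchwartzMap.derivCLM ℂ ℂ (SchwartzMap.derivCLM ℂ ℂ
        (SchwartzMap.derivCLM ℂ ℂ (φ.1 j t))) := rfl

theorem spaceDeriv_adjointOp (a b : ℝ) (φ : TestSpace T) :
    spaceDeriv (adjointOp a b φ) = adjointOp a b (spaceDeriv φ) := by
  refine Subtype.ext (funext fun j => ContinuousMap.ext fun t => ?_)
  rw [spaceDeriv_apply, adjointOp_apply, adjointOp_apply]
  simp only [map_add, map_sub, map_smul, spaceDeriv_apply]

/-- With $\xi=2\pi\eta$, the inverse transform turns $\partial_x$ into $-i\xi$, so the adjoint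
operator becomes $i(\partial_t+ip(\xi))$, with integrating factor $e^{itp(\xi)}$: the symbol of $G$.
-/
theorem fourierInvAt_adjointOp (a b η : ℝ) (φ : TestSpace T) (j : ℕ) (t : Icc (0 : ℝ) T) :
    fourierInvAt η ((adjointOp a b φ).1 j t) = Complex.I * (fourierInvAt η (φ.1 (j + 1) t)
      + Complex.I * ((2 * Real.pi * η) ^ 3 - a * (2 * Real.pi * η) ^ 2 - b * (2 * Real.pi * η) : ℝ)
        * fourierInvAt η (φ.1 j t)) := by
  rw [adjointOp_apply]
  simp only [map_add, map_sub, map_smul, fourierInvAt_derivCLM, smul_eq_mul]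
  push_cast
  generalize fourierInvAt η (φ.1 j t) = z
  have h3 : Complex.I ^ 3 = -Complex.I := Complex.I_pow_three
  have h4 : Complex.I ^ 4 = 1 := Complex.I_pow_four
  have h2 : Complex.I ^ 2 = -1 := Complex.I_sq
  ring_nf
  rw [h4, h2]
  ring

/-- Time derivatives of test functions are limits in the Schwartz topology, hence pass through
continuous functionals. The extension by `projIcc` is the identity near interior times. -/
theorem hasDerivAt_clm_testSpace (hT : 0 ≤ T) (φ : TestSpace T) (j : ℕ) (ℓ : 𝓢(ℝ, ℂ) →L[ℂ] ℂ)
    {t : ℝ} (ht : t ∈ Ioo 0 T) :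
    HasDerivAt (fun s => ℓ (φ.1 j (projIcc 0 T hT s))) (ℓ (φ.1 (j + 1) (projIcc 0 T hT t))) t := by
  have htc : t ∈ Icc 0 T := Ioo_subset_Icc_self ht
  rw [hasDerivAt_iff_tendsto_slope]
  have hproj : Tendsto (projIcc 0 T hT) (𝓝[≠] t) (𝓝[≠] (projIcc 0 T hT t)) := by
    rw [tendsto_nhdsWithin_iff]
    refine ⟨(continuous_projIcc.tendsto t).mono_left nhdsWithin_le_nhds, ?_⟩
    have h1 : ∀ᶠ s in 𝓝[≠] t, s ∈ Ioo 0 T :=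
      nhdsWithin_le_nhds (isOpen_Ioo.mem_nhds ht)
    filter_upwards [h1, self_mem_nhdsWithin] with s hs hne
    rw [projIcc_of_mem hT htc, projIcc_of_mem hT (Ioo_subset_Icc_self hs)]
    exact fun h => hne (congrArg Subtype.val h)
  refine (((ℓ.continuous.tendsto _).comp (φ.2 j (projIcc 0 T hT t))).comp hproj).congr' ?_
  have h1 : ∀ᶠ s in 𝓝[≠] t, s ∈ Ioo 0 T :=
    nhdsWithin_le_nhds (isOpen_Ioo.mem_nhds ht)
  filter_upwards [h1] with s hs
  simp only [Function.comp_apply, slope_def_module]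
  rw [projIcc_of_mem hT htc, projIcc_of_mem hT (Ioo_subset_Icc_self hs), ← Complex.coe_smul,
    map_smul, map_sub, Complex.coe_smul]

/-- A curve in the Schwartz space, transformed by a continuous linear map. -/
noncomputable def curveMap (A : 𝓢(ℝ, ℂ) →L[ℂ] 𝓢(ℝ, ℂ)) (Φ : C(Icc (0 : ℝ) T, 𝓢(ℝ, ℂ))) :
    C(Icc (0 : ℝ) T, 𝓢(ℝ, ℂ)) := ⟨fun t => A (Φ t), A.continuous.comp Φ.continuous⟩

theorem norm_curveEval_le (hT : 0 ≤ T) (N : ℕ) (Φ : C(Icc (0 : ℝ) T, 𝓢(ℝ, ℂ))) :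
    ∃ B, 0 ≤ B ∧ ∀ t x, ‖curveEval hT Φ t x‖ ≤ B * ((1 + |x|) ^ N)⁻¹ := by
  obtain ⟨B, hB, h⟩ := exists_decaySeminorm_le N Φ
  refine ⟨B, hB, fun t x => ?_⟩
  have hx := pow_pos (one_add_abs_pos x) N
  rw [← div_eq_mul_inv, le_div_iff₀' hx]
  exact (pow_mul_norm_le_decaySeminorm N _ x).trans (h _)

theorem continuous_fourierInvAt_curve (hT : 0 ≤ T) (Φ : C(Icc (0 : ℝ) T, 𝓢(ℝ, ℂ))) :
    Continuous fun p : ℝ × ℝ => fourierInvAt p.2 (Φ (projIcc 0 T hT p.1)) :=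
  continuous_curveEval hT (curveMap (FourierTransform.fourierInvCLM ℂ 𝓢(ℝ, ℂ)) Φ)

/-- Integration in time on the Fourier side. -/
theorem integral_symbol_mul_adjointOp (hT : 0 ≤ T) (a b : ℝ) (φ : TestSpace T)
    (hφ : valueAt φ ⟨T, right_mem_Icc.2 hT⟩ = 0) {τ : ℝ} (hτ : τ ∈ Ico 0 T) (η : ℝ) :
    ∫ t in Ioo τ T, symbol a b (t - τ) (2 * Real.pi * η) *
        fourierInvAt η ((adjointOp a b φ).1 0 (projIcc 0 T hT t))
      = -Complex.I * fourierInvAt η (φ.1 0 (projIcc 0 T hT τ)) := by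
  have hsym : Continuous fun t : ℝ => symbol a b (t - τ) (2 * Real.pi * η) :=
    (continuous_symbol a b).comp (by fun_prop : Continuous fun t : ℝ => (t - τ, 2 * Real.pi * η))
  have hc : ∀ Φ : C(Icc (0 : ℝ) T, 𝓢(ℝ, ℂ)),
      Continuous fun t : ℝ => fourierInvAt η (Φ (projIcc 0 T hT t)) := fun Φ =>
    (fourierInvAt η).continuous.comp (Φ.continuous.comp continuous_projIcc)
  -- The integrand is the derivative of $i\,e^{i(t-\tau)p}\hat\phi(t)$. The boundary value at $T$
  -- vanishes by assumption on $\phi$, and at $\tau$ the symbol equals $1$. The case $\tau=0$ is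
  -- included for the initial data.
  have hftc := intervalIntegral.integral_eq_sub_of_hasDerivAt_of_le hτ.2.le
    (f := fun t => Complex.I * (symbol a b (t - τ) (2 * Real.pi * η) *
      fourierInvAt η (φ.1 0 (projIcc 0 T hT t))))
    (f' := fun t => symbol a b (t - τ) (2 * Real.pi * η) *
        fourierInvAt η ((adjointOp a b φ).1 0 (projIcc 0 T hT t)))
    (continuous_const.mul (hsym.mul (hc _))).continuousOn (fun t ht => ?_)
    ((hsym.mul (hc _)).intervalIntegrable _ _)
  · rw [intervalIntegral.integral_of_le hτ.2.le, integral_Ioc_eq_integral_Ioo] at hftc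
    rw [hftc, sub_self, symbol_zero, projIcc_of_mem hT (right_mem_Icc.2 hT)]
    rw [valueAt] at hφ
    rw [hφ, map_zero]
    ring
  · have h1 := hasDerivAt_clm_testSpace hT φ 0 (fourierInvAt η)
      (⟨hτ.1.trans_lt ht.1, ht.2⟩ : t ∈ Ioo 0 T)
    have h2 : HasDerivAt (fun t => symbol a b (t - τ) (2 * Real.pi * η)) _ t :=
      (hasDerivAt_symbol a b (t - τ) (2 * Real.pi * η)).comp_sub_const t τ
    refine ((h2.mul h1).const_mul Complex.I).congr_deriv ?_
    rw [fourierInvAt_adjointOp]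
    ring

/-- This says that $G$ is a fundamental solution. Passing to the Fourier side in $x$ for each $t$,
exchanging the $t$ and $\eta$ integrals and integrating in time leaves Fourier inversion at $y$. -/
theorem integral_integral_airyKernel_mul_adjointOp (hT : 0 ≤ T) (a b : ℝ) (φ : TestSpace T)
    (hφ : valueAt φ ⟨T, right_mem_Icc.2 hT⟩ = 0) {τ : ℝ} (hτ : τ ∈ Ico 0 T) (y : ℝ) :
    ∫ t in Ioo τ T, ∫ x, airyKernel a b (t - τ) (x - y) *
        curveEval hT ((adjointOp a b φ).1 0) t x
      = -Complex.I * curveEval hT (φ.1 0) τ y := by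
  set Ψ := (adjointOp a b φ).1 0 with hΨ
  have h1 : ∫ t in Ioo τ T, ∫ x, airyKernel a b (t - τ) (x - y) * curveEval hT Ψ t x
      = ∫ t in Ioo τ T, ∫ η : ℝ, symbol a b (t - τ) (2 * Real.pi * η) *
      (Complex.exp (-(2 * Real.pi * η * y : ℝ) * Complex.I) *
        fourierInvAt η (Ψ (projIcc 0 T hT t))) :=
    setIntegral_congr_fun measurableSet_Ioo fun t ht =>
      integral_airyKernel_sub_mul (sub_pos.2 ht.1) a b y _
  obtain ⟨B, hB, hbd⟩ := norm_curveEval_le hT 2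
    (curveMap (FourierTransform.fourierInvCLM ℂ 𝓢(ℝ, ℂ)) Ψ)
  -- The oscillating factors are unimodular, so the decay of the transformed test function alone
  -- justifies the exchange, without any bound on the kernel.
  have hint : Integrable (fun p : ℝ × ℝ => symbol a b (p.1 - τ) (2 * Real.pi * p.2) *
      (Complex.exp (-(2 * Real.pi * p.2 * y : ℝ) * Complex.I) *
        fourierInvAt p.2 (Ψ (projIcc 0 T hT p.1)))) ((volume.restrict (Ioo τ T)).prod volume) := by
    have hdom : Integrable (fun p : ℝ × ℝ => B * ((1 + |p.2|) ^ 2)⁻¹)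
        ((volume.restrict (Ioo τ T)).prod volume) :=
      (integrable_const B).mul_prod integrable_inv_sq_pow
    refine hdom.mono' (Continuous.aestronglyMeasurable ?_) (ae_of_all _ fun p => ?_)
    · refine Continuous.mul ?_ (Continuous.mul (by fun_prop) (continuous_fourierInvAt_curve hT Ψ))
      exact (continuous_symbol a b).comp (by fun_prop : Continuous fun p : ℝ × ℝ =>
        (p.1 - τ, 2 * Real.pi * p.2))
    · rw [norm_mul, norm_mul, norm_symbol, one_mul, ← Complex.ofReal_neg,
        Complex.norm_exp_ofReal_mul_I, one_mul]
      exact hbd p.1 p.2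
  rw [h1, integral_integral_swap hint]
  have h2 : ∀ η : ℝ, ∫ t in Ioo τ T, symbol a b (t - τ) (2 * Real.pi * η) *
      (Complex.exp (-(2 * Real.pi * η * y : ℝ) * Complex.I) *
        fourierInvAt η (Ψ (projIcc 0 T hT t)))
      = -Complex.I * (Complex.exp (-(2 * Real.pi * η * y : ℝ) * Complex.I) *
        fourierInvAt η (φ.1 0 (projIcc 0 T hT τ))) := fun η => by
    simp_rw [mul_left_comm (symbol _ _ _ _)]
    rw [integral_const_mul, hΨ, integral_symbol_mul_adjointOp hT a b φ hφ hτ]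
    ring
  simp_rw [h2]
  rw [integral_const_mul, integral_exp_mul_fourierInvAt]
  rfl

end HNLS

/-! ## The Duhamel formula -/

namespace HNLS

section Pairing

variable {T C : ℝ} {ω : ℝ → ℝ} {k : ℝ → ℝ → ℂ}

theorem IsBoundedKernel.integrableOn_retardedKernel_mul (hk : IsBoundedKernel T C ω k)
    {q : ℝ × ℝ} (hq : 0 ≤ q.1) {φ : ℝ × ℝ → ℂ} {B : ℝ} (hφm : Continuous φ)
    (hφ : ∀ p, ‖φ p‖ ≤ B * ((1 + |p.2|) ^ 4)⁻¹) :
    IntegrableOn (fun p => retardedKernel k p q * φ p) (strip T) := by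
  refine ((integrable_timeSingularity_mul T q.1).const_mul (C * ω q.2 * B)).restrict.mono'
    (((measurable_retardedKernel hk.measurable).comp
      (measurable_prodMk_right (y := q))).aestronglyMeasurable.mul hφm.aestronglyMeasurable) ?_
  filter_upwards [ae_restrict_mem (measurableSet_strip T)] with p hp
  have hn := hk.norm_retardedKernel_le hp.1.2 hq
  have hx := one_add_abs_pos p.2
  rw [norm_mul]
  calc _ ≤ C * timeSingularity T (p.1 - q.1) * (1 + |p.2|) ^ 2 * ω q.2 *
        (B * ((1 + |p.2|) ^ 4)⁻¹) :=
        mul_le_mul hn (hφ p) (norm_nonneg _) ((norm_nonneg _).trans hn)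
    _ = _ := by field_simp

theorem setIntegral_retardedKernel_mul {q : ℝ × ℝ} (hq : q.1 ∈ Ico 0 T) {φ : ℝ × ℝ → ℂ}
    (h : IntegrableOn (fun p => retardedKernel k p q * φ p) (strip T)) :
    ∫ p in strip T, retardedKernel k p q * φ p
      = ∫ t in Ioo q.1 T, ∫ x, k (t - q.1) (x - q.2) * φ (t, x) := by
  rw [IntegrableOn, volume_restrict_strip] at h
  rw [volume_restrict_strip, integral_prod _ h]
  rw [setIntegral_eq_of_subset_of_forall_sdiff_eq_zero measurableSet_Ioo
    (Ioo_subset_Ioo_left hq.1) fun t ht => ?_]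
  · refine setIntegral_congr_fun measurableSet_Ioo fun t ht => ?_
    simp only [retardedKernel, if_pos ht.1]
  · have hle : ¬ q.1 < t := fun hlt => ht.2 ⟨hlt, ht.1.2⟩
    simp only [retardedKernel, if_neg hle, zero_mul, integral_zero]

theorem IsBoundedKernel.integrable_sub_mul (hk : IsBoundedKernel T C ω k) {s : ℝ}
    (hs : s ∈ Ioc 0 T) (y : ℝ) (ψ : 𝓢(ℝ, ℂ)) : Integrable fun x => k s (x - y) * ψ x := by
  have hω := hk.weight_pos y
  have hC := hk.nonneg
  have hs0 := hs.1
  refine (integrable_inv_sq_pow.const_mul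
    (C * s ^ (-(3 / 4) : ℝ) * ω y * decaySeminorm 4 ψ)).mono' ?_ (ae_of_all _ fun x => ?_)
  · exact (hk.measurable.comp (by fun_prop : Measurable fun x : ℝ =>
      (s, x - y))).aestronglyMeasurable.mul ψ.continuous.aestronglyMeasurable
  · have hx := one_add_abs_pos x
    have hψ : ‖ψ x‖ ≤ decaySeminorm 4 ψ * ((1 + |x|) ^ 4)⁻¹ := by
      rw [← div_eq_mul_inv, le_div_iff₀' (by positivity)]
      exact pow_mul_norm_le_decaySeminorm 4 ψ x
    rw [norm_mul]
    calc _ ≤ C * s ^ (-(3 / 4) : ℝ) * (1 + |x|) ^ 2 * ω y *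
          (decaySeminorm 4 ψ * ((1 + |x|) ^ 4)⁻¹) :=
          mul_le_mul (hk.bound s hs x y) hψ (norm_nonneg _) (by positivity)
      _ = _ := by field_simp

theorem exists_isBoundedKernel (a b : ℝ) (hT : 0 < T) :
    ∃ C, IsBoundedKernel T C leftWeight (airyKernel a b) ∧
      IsBoundedKernel T C rightWeight (airyKernelDeriv a b) := by
  obtain ⟨C, hC, h⟩ := exists_norm_airyKernel_sub_le a b hT
  exact ⟨C, ⟨measurable_airyKernel a b, continuous_leftWeight.measurable, leftWeight_pos, hC,
      fun t ht x y => (h t ht x y).1⟩,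
    ⟨measurable_airyKernelDeriv a b, continuous_rightWeight.measurable,
      fun y => one_pos.trans_le (one_le_rightWeight y), hC, fun t ht x y => (h t ht x y).2⟩⟩

/-- Integration by parts. There are no boundary terms at infinity, since the product and both of its
derivative terms are integrable. -/
theorem integral_airyKernelDeriv_sub_mul (a b : ℝ) {s : ℝ} (hs : 0 < s) (y : ℝ) (ψ : 𝓢(ℝ, ℂ)) :
    ∫ x, airyKernelDeriv a b s (x - y) * ψ x
      = -∫ x, airyKernel a b s (x - y) * SchwartzMap.derivCLM ℂ ℂ ψ x := by
  -- The kernel bounds are used on $(0,s]$, at the right endpoint $s$.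
  obtain ⟨C, h1, h2⟩ := exists_isBoundedKernel a b hs
  have hmem : s ∈ Ioc 0 s := ⟨hs, le_rfl⟩
  have h := integral_mul_deriv_eq_deriv_mul_of_integrable
    (u := fun x => airyKernel a b s (x - y)) (v := ψ)
    (u' := fun x => airyKernelDeriv a b s (x - y)) (v' := SchwartzMap.derivCLM ℂ ℂ ψ)
    (fun x _ => (hasDerivAt_airyKernel a b s (x - y)).comp_sub_const x y)
    (fun x _ => ψ.hasDerivAt x) (h1.integrable_sub_mul hmem y _) (h2.integrable_sub_mul hmem y _)
    (h1.integrable_sub_mul hmem y _)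
  rw [h, neg_neg]

theorem setIntegral_airyKernel_mul_adjointOp (a b : ℝ) (hT : 0 < T) (φ : TestSpace T)
    (hφ : valueAt φ ⟨T, right_mem_Icc.2 hT.le⟩ = 0) {q : ℝ × ℝ} (hq : q.1 ∈ Ico 0 T) :
    ∫ p in strip T, retardedKernel (airyKernel a b) p q *
        curveEval hT.le ((adjointOp a b φ).1 0) p.1 p.2
      = -Complex.I * curveEval hT.le (φ.1 0) q.1 q.2 := by
  obtain ⟨C, h1, -⟩ := exists_isBoundedKernel a b hT
  obtain ⟨B, -, hB⟩ := norm_curveEval_le hT.le 4 ((adjointOp a b φ).1 0)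
  rw [setIntegral_retardedKernel_mul hq (h1.integrableOn_retardedKernel_mul hq.1
    (continuous_curveEval hT.le _) fun p => hB p.1 p.2)]
  exact integral_integral_airyKernel_mul_adjointOp hT.le a b φ hφ hq q.2

/-- The derivative moves to the test function with a minus sign and commutes with the
constant-coefficient adjoint operator, so the identity for $G$ applies to $\phi_x$, which also
vanishes at $T$. -/
theorem setIntegral_airyKernelDeriv_mul_adjointOp (a b : ℝ) (hT : 0 < T) (φ : TestSpace T)
    (hφ : valueAt φ ⟨T, right_mem_Icc.2 hT.le⟩ = 0) {q : ℝ × ℝ} (hq : q.1 ∈ Ico 0 T) :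
    ∫ p in strip T, retardedKernel (airyKernelDeriv a b) p q *
        curveEval hT.le ((adjointOp a b φ).1 0) p.1 p.2
      = Complex.I * curveEval hT.le ((spaceDeriv φ).1 0) q.1 q.2 := by
  obtain ⟨C, -, h2⟩ := exists_isBoundedKernel a b hT
  obtain ⟨B, -, hB⟩ := norm_curveEval_le hT.le 4 ((adjointOp a b φ).1 0)
  have hφ' : valueAt (spaceDeriv φ) ⟨T, right_mem_Icc.2 hT.le⟩ = 0 := by
    rw [valueAt] at hφ ⊢
    rw [spaceDeriv_apply, hφ, map_zero]
  rw [setIntegral_retardedKernel_mul hq (h2.integrableOn_retardedKernel_mul hq.1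
    (continuous_curveEval hT.le _) fun p => hB p.1 p.2)]
  have h := integral_integral_airyKernel_mul_adjointOp hT.le a b _ hφ' hq q.2
  rw [← spaceDeriv_adjointOp] at h
  have e : ∫ t in Ioo q.1 T, ∫ x, airyKernelDeriv a b (t - q.1) (x - q.2) *
        curveEval hT.le ((adjointOp a b φ).1 0) t x
      = ∫ t in Ioo q.1 T, -∫ x, airyKernel a b (t - q.1) (x - q.2) *
        curveEval hT.le ((spaceDeriv (adjointOp a b φ)).1 0) t x :=
    setIntegral_congr_fun measurableSet_Ioo fun t ht =>
      integral_airyKernelDeriv_sub_mul a b (sub_pos.2 ht.1) q.2 _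
  rw [e, integral_neg, h]
  ring

end Pairing

section Duhamel

variable {T : ℝ} {k : ℝ → ℝ → ℂ} {f : ℝ → ℝ → ℂ}

theorem strip_subset_strip {t T : ℝ} (h : t ≤ T) : strip t ⊆ strip T :=
  prod_mono (Ioo_subset_Ioo_right h) le_rfl

theorem retardedKernel_of_mem_strip {t x : ℝ} {q : ℝ × ℝ} (hq : q ∈ strip t) :
    retardedKernel k (t, x) q = k (t - q.1) (x - q.2) := if_pos hq.1.2

theorem integrableOn_of_integrable_retardedKernel {t x : ℝ} (ht : t ∈ Ioo 0 T)
    (h : IntegrableOn (fun q => retardedKernel k (t, x) q * f q.1 q.2) (strip T)) :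
    IntegrableOn (fun q : ℝ × ℝ => k (t - q.1) (x - q.2) * f q.1 q.2) (strip t) :=
  (h.mono_set (strip_subset_strip ht.2.le)).congr_fun
    (fun q hq => by simp only [retardedKernel_of_mem_strip hq]) (measurableSet_strip t)

/-- The retarded kernel vanishes for $\tau\ge t$. Absolute convergence is what allows the integral
over the strip to be written as an iterated one. -/
theorem potential_strip_eq {t x : ℝ} (ht : t ∈ Ioo 0 T)
    (h : IntegrableOn (fun q : ℝ × ℝ => k (t - q.1) (x - q.2) * f q.1 q.2) (strip t)) :
    potential k (volume.restrict (strip T)) (fun q => f q.1 q.2) (t, x)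
      = ∫ τ in (0 : ℝ)..t, ∫ y, k (t - τ) (x - y) * f τ y := by
  rw [potential, setIntegral_eq_of_subset_of_forall_sdiff_eq_zero (measurableSet_strip T)
    (strip_subset_strip ht.2.le) fun q hq => ?_]
  · rw [setIntegral_congr_fun (measurableSet_strip t)
      (g := fun q : ℝ × ℝ => k (t - q.1) (x - q.2) * f q.1 q.2)
      fun q hq => by simp only [retardedKernel_of_mem_strip hq]]
    rw [IntegrableOn, volume_restrict_strip] at h
    rw [volume_restrict_strip, integral_prod _ h, intervalIntegral.integral_of_le ht.1.le,
      integral_Ioc_eq_integral_Ioo]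
  · have hle : ¬ q.1 < t := fun hlt => hq.2 ⟨⟨hq.1.1.1, hlt⟩, mem_univ _⟩
    rw [retardedKernel, if_neg hle, zero_mul]

/-- The measure carrying the initial data: Lebesgue measure on the line `t = 0`. -/
noncomputable def initialMeasure : Measure (ℝ × ℝ) := volume.map (Prod.mk (0 : ℝ))

theorem measurableEmbedding_initial : MeasurableEmbedding (Prod.mk (0 : ℝ) : ℝ → ℝ × ℝ) :=
  measurableEmbedding_prodMk_left 0

instance : SFinite initialMeasure := by
  unfold initialMeasure
  infer_instance

theorem ae_initialMeasure : ∀ᵐ q ∂initialMeasure, q.1 = 0 := by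
  rw [initialMeasure, measurableEmbedding_initial.ae_map_iff]
  exact ae_of_all _ fun _ => rfl

theorem integral_initialMeasure (g : ℝ × ℝ → ℂ) :
    ∫ q, g q ∂initialMeasure = ∫ y, g (0, y) :=
  measurableEmbedding_initial.integral_map g

theorem integrable_initialMeasure_iff {g : ℝ × ℝ → ℂ} :
    Integrable g initialMeasure ↔ Integrable fun y => g (0, y) :=
  measurableEmbedding_initial.integrable_map_iff

theorem potential_initialMeasure_eq {t : ℝ} (ht : 0 < t) (x : ℝ) (u₀ : ℝ → ℂ) :
    potential k initialMeasure (fun q => u₀ q.2) (t, x) = ∫ y, k t (x - y) * u₀ y := by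
  rw [potential, integral_initialMeasure]
  simp only [retardedKernel, if_pos ht, sub_zero]

variable {a b : ℝ} {u₀ : ℝ → ℂ} {f₁ f₂ : ℝ → ℝ → ℂ}

theorem duhamelConvergesAt_iff {t x : ℝ} : DuhamelConvergesAt a b f₁ f₂ t x ↔
    IntegrableOn (fun q : ℝ × ℝ => airyKernel a b (t - q.1) (x - q.2) * f₁ q.1 q.2) (strip t) ∧
    IntegrableOn (fun q : ℝ × ℝ => airyKernelDeriv a b (t - q.1) (x - q.2) * f₂ q.1 q.2)
      (strip t) := by
  unfold DuhamelConvergesAt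
  refine and_congr (integrableOn_congr_fun (fun q hq => ?_) (measurableSet_strip t))
    (integrableOn_congr_fun (fun q hq => ?_) (measurableSet_strip t))
  · simp only [G_eq_airyKernel (sub_pos.2 hq.1.2)]
  · simp only [Gx_eq_airyKernelDeriv (sub_pos.2 hq.1.2)]

theorem duhamel_eq {t : ℝ} (ht : 0 < t) (x : ℝ) : duhamel a b u₀ f₁ f₂ t x
    = (∫ y, airyKernel a b t (x - y) * u₀ y)
    - Complex.I * (∫ τ in (0 : ℝ)..t, ∫ y, airyKernel a b (t - τ) (x - y) * f₁ τ y)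
    - Complex.I * (∫ τ in (0 : ℝ)..t, ∫ y, airyKernelDeriv a b (t - τ) (x - y) * f₂ τ y) := by
  rw [duhamel, G_eq_airyKernel ht]
  simp only [intervalIntegral.integral_of_le ht.le, integral_Ioc_eq_integral_Ioo]
  congr 1
  · congr 2
    exact setIntegral_congr_fun measurableSet_Ioo fun τ hτ => by
      simp only [G_eq_airyKernel (sub_pos.2 hτ.2)]
  · congr 1
    exact setIntegral_congr_fun measurableSet_Ioo fun τ hτ => by
      simp only [Gx_eq_airyKernelDeriv (sub_pos.2 hτ.2)]

theorem duhamel_eq_potential {t x : ℝ} (ht : t ∈ Ioo 0 T)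
    (h : DuhamelConvergesAt a b f₁ f₂ t x) : duhamel a b u₀ f₁ f₂ t x
    = potential (airyKernel a b) initialMeasure (fun q => u₀ q.2) (t, x)
      - Complex.I * potential (airyKernel a b) (volume.restrict (strip T))
        (fun q => f₁ q.1 q.2) (t, x)
      - Complex.I * potential (airyKernelDeriv a b) (volume.restrict (strip T))
        (fun q => f₂ q.1 q.2) (t, x) := by
  rw [duhamelConvergesAt_iff] at h
  rw [duhamel_eq ht.1, potential_initialMeasure_eq ht.1, potential_strip_eq ht h.1,
    potential_strip_eq ht h.2]

theorem ae_strip_of_ae {P : ℝ → ℝ → Prop}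
    (h : ∀ᵐ t ∂(volume.restrict (Ioo 0 T)), ∀ x, P t x) :
    ∀ᵐ p ∂(volume.restrict (strip T)), P p.1 p.2 := by
  rw [volume_restrict_strip]
  exact (Measure.quasiMeasurePreserving_fst.ae h).mono fun p hp => hp p.2

theorem integral_sub_const_mul_sub_const_mul {α : Type*} [MeasurableSpace α] {μ : Measure α}
    {g₀ g₁ g₂ : α → ℂ} (h₀ : Integrable g₀ μ) (h₁ : Integrable g₁ μ) (h₂ : Integrable g₂ μ)
    {c : ℂ} : ∫ p, (g₀ p - c * g₁ p - c * g₂ p) ∂μ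
      = ∫ p, g₀ p ∂μ - c * ∫ p, g₁ p ∂μ - c * ∫ p, g₂ p ∂μ := by
  have h : Integrable (fun p => g₀ p - c * g₁ p) μ := h₀.sub (h₁.const_mul c)
  rw [integral_sub h (h₂.const_mul c), integral_sub h₀ (h₁.const_mul c), integral_const_mul,
    integral_const_mul]

end Duhamel

end HNLS

/-! ### The theorem: verification of the weak equation and of convergence -/

open HNLS

theorem theorem2p1 (a b T ε : ℝ) (hT : 0 < T) (hε : 0 < ε)
    (u₀ : ℝ → ℂ) (f₁₁ f₁₂ f₁ f₂ : ℝ → ℝ → ℂ)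
    (hu₀ : HNLS.MemWeightedLp (1 / 4 + ε) 2 u₀)
    (hf₁₁ : HNLS.MemL1WeightedLp T (1 / 4 + ε) 2 f₁₁)
    (hf₁₂ : HNLS.MemL1WeightedLp T (-(1 / 4)) 1 f₁₂)
    (hf₁ : f₁ = f₁₁ + f₁₂)
    (hf₂ : HNLS.MemL1WeightedLp T (1 / 4) 1 f₂) :
    -- `G(t,·)` and `G_x(t,·)` exist as functions for `t > 0`
    (∀ t : ℝ, 0 < t →
      HNLS.IsTemperedGivenBy (HNLS.fundamentalDistribution a b t) (HNLS.G a b t) ∧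
        Differentiable ℝ (HNLS.G a b t)) ∧
    ∃ u : ℝ → ℝ → ℂ,
      -- `u` is a generalized solution
      (∃ (U₀ : TemperedDistribution ℝ ℂ) (F₁ F₂ U : HNLS.DualSpace T),
        HNLS.IsTemperedGivenBy U₀ u₀ ∧ HNLS.IsGivenBy F₁ f₁ ∧ HNLS.IsGivenBy F₂ f₂ ∧
          HNLS.IsGivenBy U u ∧ HNLS.IsGeneralizedSolution hT.le a b U₀ F₁ F₂ U) ∧
      -- the integral with `u₀` converges absolutely at every point of the strip
      (∀ t ∈ Set.Ioo 0 T, ∀ x : ℝ,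
        MeasureTheory.Integrable (fun y : ℝ => HNLS.G a b t (x - y) * u₀ y)) ∧
      -- the other two converge absolutely for almost all `t` and all `x`
      (∀ᵐ t ∂(MeasureTheory.volume.restrict (Set.Ioo 0 T)), ∀ x : ℝ,
        HNLS.DuhamelConvergesAt a b f₁ f₂ t x) ∧
      -- the formula holds at every point where they converge absolutely
      (∀ t ∈ Set.Ioo 0 T, ∀ x : ℝ, HNLS.DuhamelConvergesAt a b f₁ f₂ t x →
        u t x = HNLS.duhamel a b u₀ f₁ f₂ t x) := by
  obtain ⟨C, hk, hk'⟩ := exists_isBoundedKernel a b hT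
  have hu : Integrable fun y => leftWeight y • u₀ y := hu₀.integrable_leftWeight hε
  have h1 : IntegrableOn (fun p : ℝ × ℝ => leftWeight p.2 • f₁ p.1 p.2) (strip T) := by
    refine ((hf₁₁.integrableOn_leftWeight hε).add hf₁₂.integrableOn_leftWeight_of_one).congr
      (ae_of_all _ fun p => ?_)
    simp only [Pi.add_apply, hf₁, smul_add]
  have h2 : IntegrableOn (fun p : ℝ × ℝ => rightWeight p.2 • f₂ p.1 p.2) (strip T) :=
    hf₂.integrableOn
  have hu' : Integrable (fun q : ℝ × ℝ => leftWeight q.2 • u₀ q.2) initialMeasure :=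
    integrable_initialMeasure_iff.2 hu
  have hm0 : ∀ᵐ q ∂initialMeasure, (0 : ℝ) ≤ q.1 := ae_initialMeasure.mono fun q hq => hq.ge
  have hmem : ∀ᵐ q ∂(volume.restrict (strip T)), q ∈ strip T :=
    ae_restrict_mem (measurableSet_strip T)
  have hm : ∀ᵐ q ∂(volume.restrict (strip T)), (0 : ℝ) ≤ q.1 := hmem.mono fun q hq => hq.1.1.le
  have hw : ∀ y : ℝ, 0 ≤ ((1 + |y|) ^ 1)⁻¹ := fun y => by positivity
  have hwl : ∀ y : ℝ, ((1 + |y|) ^ 1)⁻¹ ≤ leftWeight y := fun y => by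
    rw [pow_one]
    exact inv_one_add_abs_le_leftWeight y
  have hwr : ∀ y : ℝ, ((1 + |y|) ^ 1)⁻¹ ≤ rightWeight y := fun y =>
    (hwl y).trans ((leftWeight_le_one y).trans (one_le_rightWeight y))
  have hwm := (continuous_inv_pow 1).measurable
  obtain ⟨U₀, hU₀⟩ := exists_isTemperedGivenBy (N := 1) (integrable_smul_of_le hu hwm
    continuous_leftWeight.measurable hw hwl leftWeight_pos)
  obtain ⟨F₁, hF₁⟩ := exists_isGivenBy hT (N := 1) (integrable_smul_of_le h1
    (hwm.comp measurable_snd) (continuous_leftWeight.measurable.comp measurable_snd)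
    (fun p => hw p.2) (fun p => hwl p.2) (fun p => leftWeight_pos p.2))
  obtain ⟨F₂, hF₂⟩ := exists_isGivenBy hT (N := 1) (integrable_smul_of_le h2
    (hwm.comp measurable_snd) (continuous_rightWeight.measurable.comp measurable_snd)
    (fun p => hw p.2) (fun p => hwr p.2) (fun p => one_pos.trans_le (one_le_rightWeight p.2)))
  have hconv : ∀ᵐ t ∂(volume.restrict (Ioo 0 T)), ∀ x, DuhamelConvergesAt a b f₁ f₂ t x := by
    filter_upwards [hk.ae_forall_integrable h1 hm, hk'.ae_forall_integrable h2 hm,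
      ae_restrict_mem measurableSet_Ioo] with t e1 e2 ht x
    exact duhamelConvergesAt_iff.2 ⟨integrableOn_of_integrable_retardedKernel ht (e1 x),
      integrableOn_of_integrable_retardedKernel ht (e2 x)⟩
  -- The Duhamel expression is identified with the potentials only where the double integrals
  -- converge, that is almost everywhere, which suffices under an integral.
  have hueq : ∀ᵐ p ∂(volume.restrict (strip T)), duhamel a b u₀ f₁ f₂ p.1 p.2
      = potential (airyKernel a b) initialMeasure (fun q => u₀ q.2) p
      - Complex.I * potential (airyKernel a b) (volume.restrict (strip T))
        (fun q => f₁ q.1 q.2) p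
      - Complex.I * potential (airyKernelDeriv a b) (volume.restrict (strip T))
        (fun q => f₂ q.1 q.2) p := by
    filter_upwards [ae_strip_of_ae hconv, hmem] with p hp hpT
    exact duhamel_eq_potential hpT.1 hp
  -- Order $4$: two powers for the growth of the kernels in $x$ and two for integrability in $x$.
  have hgrowth : IntegrableOn (fun p : ℝ × ℝ => (((1 + |p.2|) ^ 4)⁻¹ : ℝ) •
      duhamel a b u₀ f₁ f₂ p.1 p.2) (strip T) := by
    refine (((hk.integrableOn_inv_pow_smul_potential hu' hm0).sub
      ((hk.integrableOn_inv_pow_smul_potential h1 hm).const_mul Complex.I)).sub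
      ((hk'.integrableOn_inv_pow_smul_potential h2 hm).const_mul Complex.I)).congr
      (hueq.mono fun p hp => ?_)
    simp only [Pi.sub_apply, hp, smul_sub, mul_smul_comm]
  obtain ⟨U, hU⟩ := exists_isGivenBy hT hgrowth
  -- Taking $u$ to be the Duhamel expression at every point makes the representation formula
  -- definitional.
  refine ⟨fun t ht => ?_, duhamel a b u₀ f₁ f₂, ⟨U₀, F₁, F₂, U, hU₀, hF₁, hF₂, hU, ?_⟩, ?_, hconv,
    fun t _ x _ => rfl⟩
  · rw [G_eq_airyKernel ht]
    exact ⟨isTemperedGivenBy_airyKernel ht a b,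
      fun x => (hasDerivAt_airyKernel a b t x).differentiableAt⟩
  · intro φ hφ
    obtain ⟨B, -, hB⟩ := norm_curveEval_le hT.le 4 ((adjointOp a b φ).1 0)
    have hψm := (continuous_curveEval hT.le ((adjointOp a b φ).1 0)).aestronglyMeasurable
      (μ := volume.restrict (strip T))
    have hψ : ∀ᵐ p : ℝ × ℝ ∂(volume.restrict (strip T)),
        ‖curveEval hT.le ((adjointOp a b φ).1 0) p.1 p.2‖ ≤ B * ((1 + |p.2|) ^ 4)⁻¹ :=
      ae_of_all _ fun p => hB p.1 p.2
    obtain ⟨i0, e0⟩ := hk.integrable_potential_mul hu' hm0 hψm hψ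
    obtain ⟨i1, e1⟩ := hk.integrable_potential_mul h1 hm hψm hψ
    obtain ⟨i2, e2⟩ := hk'.integrable_potential_mul h2 hm hψm hψ
    -- After Fubini each of the three terms contains the kernel applied to the adjoint of $\phi$,
    -- which returns $-i\phi$ for $G$ and $i\phi_x$ for $G_x$. The Duhamel factors $-i$ then give
    -- the signs of $f_1$ and $f_2$.
    have hUφ : U (adjointOp a b φ)
        = -Complex.I * U₀ (valueAt φ ⟨0, left_mem_Icc.2 hT.le⟩) - F₁ φ + F₂ (spaceDeriv φ) := by
      rw [(hU _).2, (hU₀ _).2, (hF₁ _).2, (hF₂ _).2]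
      have es : ∫ p in strip T, duhamel a b u₀ f₁ f₂ p.1 p.2 * evalAt (adjointOp a b φ) p.1 p.2
          = ∫ p in strip T, (potential (airyKernel a b) initialMeasure (fun q => u₀ q.2) p *
              curveEval hT.le ((adjointOp a b φ).1 0) p.1 p.2
            - Complex.I * (potential (airyKernel a b) (volume.restrict (strip T))
              (fun q => f₁ q.1 q.2) p * curveEval hT.le ((adjointOp a b φ).1 0) p.1 p.2)
            - Complex.I * (potential (airyKernelDeriv a b) (volume.restrict (strip T))
              (fun q => f₂ q.1 q.2) p * curveEval hT.le ((adjointOp a b φ).1 0) p.1 p.2)) := by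
        refine integral_congr_ae ?_
        filter_upwards [hueq, hmem] with p hp hpT
        rw [hp, evalAt_eq_curveEval hT.le _ (Ioo_subset_Icc_self hpT.1)]
        ring
      rw [es, integral_sub_const_mul_sub_const_mul i0 i1 i2, e0, e1, e2]
      have g0 : ∫ q, u₀ q.2 * (∫ p in strip T, retardedKernel (airyKernel a b) p q *
          curveEval hT.le ((adjointOp a b φ).1 0) p.1 p.2) ∂initialMeasure
          = -Complex.I * ∫ x, u₀ x * valueAt φ ⟨0, left_mem_Icc.2 hT.le⟩ x := by
        rw [integral_initialMeasure, ← integral_const_mul]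
        congr 1
        ext y
        rw [setIntegral_airyKernel_mul_adjointOp a b hT φ hφ (left_mem_Ico.2 hT), curveEval,
          projIcc_of_mem hT.le (left_mem_Icc.2 hT.le), valueAt]
        ring
      have g1 : ∫ q in strip T, f₁ q.1 q.2 * (∫ p in strip T,
          retardedKernel (airyKernel a b) p q *
          curveEval hT.le ((adjointOp a b φ).1 0) p.1 p.2)
          = -Complex.I * ∫ q in strip T, f₁ q.1 q.2 * evalAt φ q.1 q.2 := by
        rw [← integral_const_mul]
        refine setIntegral_congr_fun (measurableSet_strip T) fun q hq => ?_
        rw [setIntegral_airyKernel_mul_adjointOp a b hT φ hφ (Ioo_subset_Ico_self hq.1),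
          evalAt_eq_curveEval hT.le _ (Ioo_subset_Icc_self hq.1)]
        ring
      have g2 : ∫ q in strip T, f₂ q.1 q.2 * (∫ p in strip T,
          retardedKernel (airyKernelDeriv a b) p q *
          curveEval hT.le ((adjointOp a b φ).1 0) p.1 p.2)
          = Complex.I * ∫ q in strip T, f₂ q.1 q.2 * evalAt (spaceDeriv φ) q.1 q.2 := by
        rw [← integral_const_mul]
        refine setIntegral_congr_fun (measurableSet_strip T) fun q hq => ?_
        rw [setIntegral_airyKernelDeriv_mul_adjointOp a b hT φ hφ (Ioo_subset_Ico_self hq.1),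
          evalAt_eq_curveEval hT.le _ (Ioo_subset_Icc_self hq.1)]
        ring
      rw [g0, g1, g2]
      linear_combination (∫ q in strip T, f₁ q.1 q.2 * evalAt φ q.1 q.2) * Complex.I_sq
        - (∫ q in strip T, f₂ q.1 q.2 * evalAt (spaceDeriv φ) q.1 q.2) * Complex.I_sq
    have hL : U (Complex.I • timeDeriv φ - (a : ℂ) • spaceDeriv (spaceDeriv φ)
        + (Complex.I * b) • spaceDeriv φ
        + Complex.I • spaceDeriv (spaceDeriv (spaceDeriv φ))) = U (adjointOp a b φ) := rfl
    rw [hL, hUφ]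
    ring
  · intro t ht x
    rw [G_eq_airyKernel ht.1]
    have hum := aestronglyMeasurable_of_smul continuous_leftWeight.measurable
      (fun y => (leftWeight_pos y).ne') hu.aestronglyMeasurable
    refine (hu.norm.const_mul (C * t ^ (-(3 / 4) : ℝ) * (1 + |x|) ^ 2)).mono'
      (((continuous_airyKernel a b t).comp (by fun_prop)).aestronglyMeasurable.mul hum)
      (ae_of_all _ fun y => ?_)
    rw [norm_mul, norm_smul, Real.norm_eq_abs, abs_of_pos (leftWeight_pos y), ← mul_assoc]
    exact mul_le_mul_of_nonneg_right (hk.bound t ⟨ht.1, ht.2.le⟩ x y) (norm_nonneg _)
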